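/- Let $\lambda>0$ be such that $\int_{\mathcal D}\rho=1$, where $\mathcal D=B(0,\lambda)\subset\mathbb R^2$ is the open disk and $\rho(x)=\max(\lambda^2-|x|^2,0)$. Put $\sigma=\frac1{\sqrt2}\int_0^1(1-t^2)\,dt$. For $\alpha_1\in(0,1)$ and $\alpha_2=1-\alpha_1$, let $X$ be the set of all $\varphi\in BV_{\mathrm{loc}}(\mathcal D;\{0,\pi\})$ with $\int_{\mathbb R^2}\rho\cos\varphi=\alpha_1-\alpha_2$, and for $\varphi\in X$ let $$\mathcal F(\varphi)=\frac{2\sigma}{\pi}\int_{\mathcal D}\rho^{3/2}\,|D\varphi|\in[0,\infty],$$ where $|D\varphi|$ is the total variation measure of the distributional gradient of $\varphi$ in $\mathcal D$. Functions are identified when they agree almost everywhere in $\mathcal D$. Let $f(\alpha)=(1-\alpha)^{3/4}\bigl(1-\sqrt{1-\alpha}\bigr)^{1/2}$ for $\alpha\in[0,1]$. (0) $f(\alpha)>\frac3{16}$ for every $\alpha\in[\delta,1-\delta]$ with $\delta=0.1486$. Now let $\delta_0\in(0,\frac12]$ be any number such that $f(\alpha)>\frac3{16}$ for every $\alpha\in[\delta_0,1-\delta_0]$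 (for example $\delta_0=0.1486$), and let $\alpha_1\in[\delta_0,1-\delta_0]$. Then: (1) No minimizer of $\mathcal F$ in $X$ is radially symmetric. (2) For every radially symmetric $\varphi\in X$, the set $\{\varphi=0\}$ is, up to a null set, a countable union of pairwise disjoint annuli $\{a<|x|<b\}$, $0\le a\le b\le\lambda$, centred at the origin. (3) There is $\varphi_{ds}\in X$ such that $\{\varphi_{ds}=0\}$ is, up to a null set, a sector of the disk $\mathcal D$ (with apex at the origin and opening angle in $(0,2\pi)$). Every such $\varphi_{ds}$ satisfies $\mathcal F(\varphi_{ds})/(8\sigma)=\frac3{16}$, and $\mathcal F(\varphi)>\mathcal F(\varphi_{ds})$ for every radially symmetric $\varphi\in X$. -/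

import Mathlib

noncomputable section

namespace TwoBEC

open MeasureTheory Set
open scoped ENNReal ContDiff

/-- The Euclidean plane. -/
abbrev Plane : Type := EuclideanSpace ℝ (Fin 2)

/-- The open disk `𝒟 = B(0, lam)`. -/
def disk (lam : ℝ) : Set Plane := Metric.ball 0 lam

/-- The density `ρ(x) = max (lam² - |x|², 0)`. -/
def rho (lam : ℝ) (x : Plane) : ℝ := max (lam ^ 2 - ‖x‖ ^ 2) 0

/-- `σ = (1 / √2) ∫₀¹ (1 - t²) dt`. -/
def sigma : ℝ := (1 / √2) * ∫ t in (0 : ℝ)..1, (1 - t ^ 2)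

/-- The divergence of a vector field on the plane. -/
def divergence (ψ : Plane → Plane) (x : Plane) : ℝ :=
  ∑ i : Fin 2, fderiv ℝ ψ x (EuclideanSpace.single i 1) i

/-- Smooth vector fields with compact support contained in `U`. -/
structure IsTestField (U : Set Plane) (ψ : Plane → Plane) : Prop where
  contDiff : ContDiff ℝ ∞ ψ
  hasCompactSupport : HasCompactSupport ψ
  tsupport_subset : tsupport ψ ⊆ U

/-- `μ` is the total variation measure `|Dφ|` of the distributional gradient of `φ` in the open
set `U`: it is a Radon measure on `U` (extended by zero to the plane), and `Dφ = ν |Dφ|` in `U`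
in the sense of distributions, for a measurable field `ν` of unit vectors. -/
structure IsVariationMeasure (U : Set Plane) (φ : Plane → ℝ) (μ : Measure Plane) : Prop where
  compl_eq_zero : μ Uᶜ = 0
  finite_on_compacts : ∀ K : Set Plane, IsCompact K → K ⊆ U → μ K < ⊤
  polar : ∃ ν : Plane → Plane, Measurable ν ∧ (∀ᵐ x ∂μ, ‖ν x‖ = 1) ∧
    ∀ ψ : Plane → Plane, IsTestField U ψ →
      ∫ x in U, φ x * divergence ψ x = - ∫ x, inner ℝ (ψ x) (ν x) ∂μ

/-- `φ ∈ BV_loc(U)`: `φ` is locally integrable in `U` and its distributional gradient is a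
(vector-valued) Radon measure in `U`. -/
def IsBVLoc (U : Set Plane) (φ : Plane → ℝ) : Prop :=
  LocallyIntegrableOn φ U volume ∧ ∃ μ : Measure Plane, IsVariationMeasure U φ μ

open Classical in
/-- The measure `|Dφ|` in `U`, for `φ ∈ BV_loc(U)`. It is unique, see `variationMeasure_eq`. -/
def variationMeasure (U : Set Plane) (φ : Plane → ℝ) : Measure Plane :=
  if h : ∃ μ : Measure Plane, IsVariationMeasure U φ μ then h.choose else 0

theorem IsVariationMeasure.sigmaFinite {U : Set Plane} (hU : IsOpen U) {φ : Plane → ℝ}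
    {μ : Measure Plane} (h : IsVariationMeasure U φ μ) : SigmaFinite μ := by
  obtain ⟨K, hK, hKU⟩ : ∃ K : ℕ → Set Plane, (∀ n, IsCompact (K n)) ∧ ⋃ n, K n = U := by
    have : LocallyCompactSpace U := hU.locallyCompactSpace
    have : IsSigmaCompact U := isSigmaCompact_iff_sigmaCompactSpace.2 inferInstance
    exact this
  refine ⟨⟨⟨fun n => K n ∪ Uᶜ, fun _ => trivial, fun n => ?_, ?_⟩⟩⟩
  · refine (measure_union_le _ _).trans_lt ?_
    rw [h.compl_eq_zero, add_zero]
    exact h.finite_on_compacts _ (hK n) (hKU ▸ subset_iUnion K n)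
  · rw [← iUnion_union, hKU, union_compl_self]

/-- A measure as in `IsVariationMeasure` is unique. -/
theorem IsVariationMeasure.unique {U : Set Plane} (hU : IsOpen U) {φ : Plane → ℝ}
    {μ₁ μ₂ : Measure Plane} (h₁ : IsVariationMeasure U φ μ₁) (h₂ : IsVariationMeasure U φ μ₂) :
    μ₁ = μ₂ := by
  have := h₁.sigmaFinite hU
  have := h₂.sigmaFinite hU
  set τ := μ₁ + μ₂ with hτ
  -- the relevant facts on each of the two measures, in terms of its density
  have key : ∀ μ : Measure Plane, SigmaFinite μ → IsVariationMeasure U φ μ → μ ≪ τ →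
      ∃ w : Plane → Plane, (∀ᵐ x ∂τ, ‖w x‖ = (μ.rnDeriv τ x).toReal) ∧
        (∀ i, LocallyIntegrableOn (fun x => w x i) U τ) ∧
        ∀ (g : Plane → ℝ) (i : Fin 2), ContDiff ℝ ∞ g → HasCompactSupport g → tsupport g ⊆ U →
          Integrable (fun x => g x * w x i) τ ∧
          ∫ x, g x * w x i ∂τ =
            - ∫ x in U, φ x * divergence (fun x => g x • EuclideanSpace.single i 1) x := by
    intro μ _ h hac
    obtain ⟨ν, hν, hν1, hdiv⟩ := h.polar
    have hbd : ∀ i, ∀ᵐ x ∂μ, ‖ν x i‖ ≤ 1 := fun i => by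
      filter_upwards [hν1] with x hx
      exact (PiLp.norm_apply_le (ν x) i).trans hx.le
    have hνi : ∀ i, Measurable fun x => ν x i := fun i => by fun_prop
    have hint : ∀ K, IsCompact K → K ⊆ U → ∀ i, IntegrableOn (fun x => ν x i) K μ := by
      intro K hK hKU i
      refine Measure.integrableOn_of_bounded (M := 1) (h.finite_on_compacts K hK hKU).ne
        (hνi i).aestronglyMeasurable (ae_restrict_of_ae (hbd i))
    refine ⟨fun x => (μ.rnDeriv τ x).toReal • ν x, ?_, ?_, ?_⟩
    · have h1 : ∀ᵐ x ∂(τ.withDensity (μ.rnDeriv τ)), ‖ν x‖ = 1 := by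
        rwa [Measure.withDensity_rnDeriv_eq _ _ hac]
      rw [ae_withDensity_iff (Measure.measurable_rnDeriv _ _)] at h1
      filter_upwards [h1] with x hx
      rw [norm_smul, Real.norm_of_nonneg ENNReal.toReal_nonneg]
      by_cases h0 : μ.rnDeriv τ x = 0
      · simp [h0]
      · rw [hx h0, mul_one]
    · intro i
      rw [locallyIntegrableOn_iff hU.isLocallyClosed]
      intro K hKU hK
      have := (integrable_indicator_iff hK.measurableSet).2 (hint K hK hKU i)
      rw [← integrable_rnDeriv_smul_iff hac] at this
      rw [← integrable_indicator_iff hK.measurableSet]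
      refine this.congr (Filter.Eventually.of_forall fun x => ?_)
      by_cases hx : x ∈ K <;> simp [hx]
    · intro g i hg hgc hgU
      have hgint : Integrable (fun x => g x * ν x i) μ := by
        have h2 : IntegrableOn (fun x => g x * ν x i) (tsupport g) μ :=
          (hint _ hgc hgU i).continuousOn_mul hg.continuous.continuousOn hgc
        rw [← integrable_indicator_iff hgc.measurableSet] at h2
        refine h2.congr (Filter.Eventually.of_forall fun x => ?_)
        by_cases hx : x ∈ tsupport g
        · simp [hx]
        · simp [hx, image_eq_zero_of_notMem_tsupport hx]
      have e : (fun x => g x * ((μ.rnDeriv τ x).toReal • ν x) i) =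
          fun x => (μ.rnDeriv τ x).toReal • (g x * ν x i) := by
        funext x; simp only [PiLp.smul_apply, smul_eq_mul]; ring
      have ht : IsTestField U (fun x => g x • (EuclideanSpace.single i 1 : Plane)) := by
        refine ⟨hg.smul contDiff_const, hgc.smul_right, ?_⟩
        exact (tsupport_smul_subset_left _ _).trans hgU
      refine ⟨?_, ?_⟩
      · rw [e, integrable_rnDeriv_smul_iff hac]; exact hgint
      · rw [e, integral_rnDeriv_smul hac, hdiv _ ht, neg_neg]
        congr 1; funext x
        simp [inner_smul_left, EuclideanSpace.inner_single_left]
  have hac₁ : μ₁ ≪ τ := (Measure.le_add_right le_rfl).absolutelyContinuous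
  have hac₂ : μ₂ ≪ τ := (Measure.le_add_left le_rfl).absolutelyContinuous
  obtain ⟨w₁, hn₁, hl₁, hi₁⟩ := key μ₁ inferInstance h₁ hac₁
  obtain ⟨w₂, hn₂, hl₂, hi₂⟩ := key μ₂ inferInstance h₂ hac₂
  have hw : ∀ i, ∀ᵐ x ∂τ, x ∈ U → w₁ x i - w₂ x i = 0 := fun i => by
    refine hU.ae_eq_zero_of_integral_contDiff_smul_eq_zero ((hl₁ i).sub (hl₂ i)) ?_
    intro g hg hgc hgU
    simp only [smul_eq_mul, mul_sub]
    rw [integral_sub (hi₁ g i hg hgc hgU).1 (hi₂ g i hg hgc hgU).1, (hi₁ g i hg hgc hgU).2,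
      (hi₂ g i hg hgc hgU).2, sub_self]
  have hUae : ∀ᵐ x ∂τ, x ∈ U := by
    rw [ae_iff]
    change τ Uᶜ = 0
    simp [hτ, h₁.compl_eq_zero, h₂.compl_eq_zero]
  rw [← Measure.withDensity_rnDeriv_eq _ _ hac₁, ← Measure.withDensity_rnDeriv_eq _ _ hac₂]
  refine withDensity_congr_ae ?_
  filter_upwards [hw 0, hw 1, hUae, hn₁, hn₂, Measure.rnDeriv_lt_top μ₁ τ,
    Measure.rnDeriv_lt_top μ₂ τ] with x h0 h1 hx e₁ e₂ f₁ f₂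
  have : w₁ x = w₂ x := by
    ext i
    fin_cases i
    · exact sub_eq_zero.1 (h0 hx)
    · exact sub_eq_zero.1 (h1 hx)
  rw [this, e₂] at e₁
  exact ((ENNReal.toReal_eq_toReal_iff' f₂.ne f₁.ne).1 e₁).symm

theorem variationMeasure_eq {U : Set Plane} (hU : IsOpen U) {φ : Plane → ℝ} {μ : Measure Plane}
    (h : IsVariationMeasure U φ μ) : variationMeasure U φ = μ := by
  have hex : ∃ μ : Measure Plane, IsVariationMeasure U φ μ := ⟨μ, h⟩
  rw [variationMeasure, dif_pos hex]
  exact IsVariationMeasure.unique hU hex.choose_spec h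

/-- The space `X` of functions `φ ∈ BV_loc(𝒟; {0, π})` with `∫ ρ cos φ = α₁ - α₂`, where
`α₂ = 1 - α₁`. Functions are only relevant up to null sets and through their values in `𝒟`. -/
def X (lam α₁ : ℝ) : Set (Plane → ℝ) :=
  {φ | IsBVLoc (disk lam) φ ∧
    (∀ᵐ x ∂(volume.restrict (disk lam)), φ x = 0 ∨ φ x = Real.pi) ∧
    ∫ x, rho lam x * Real.cos (φ x) = α₁ - (1 - α₁)}

/-- The functional `ℱ(φ) = (2σ / π) ∫_𝒟 ρ^(3/2) |Dφ|`, with values in `[0, ∞]`. -/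
def energy (lam : ℝ) (φ : Plane → ℝ) : ℝ≥0∞ :=
  ENNReal.ofReal (2 * sigma / Real.pi) *
    ∫⁻ x in disk lam, ENNReal.ofReal (rho lam x ^ (3 / 2 : ℝ)) ∂(variationMeasure (disk lam) φ)

/-- `φ` is radially symmetric in `𝒟` (up to a null set). -/
def IsRadial (lam : ℝ) (φ : Plane → ℝ) : Prop :=
  ∃ g : ℝ → ℝ, ∀ᵐ x ∂(volume.restrict (disk lam)), φ x = g ‖x‖

/-- `φ` minimizes `ℱ` in `X`. -/
def IsMinimizer (lam α₁ : ℝ) (φ : Plane → ℝ) : Prop :=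
  φ ∈ X lam α₁ ∧ ∀ ψ ∈ X lam α₁, energy lam φ ≤ energy lam ψ

/-- The sector of the disk `𝒟` of the directions `θ₀ < θ < θ₀ + β`. -/
def sector (lam θ₀ β : ℝ) : Set Plane :=
  {x | ∃ r θ : ℝ, 0 < r ∧ r < lam ∧ θ₀ < θ ∧ θ < θ₀ + β ∧
    x = !₂[r * Real.cos θ, r * Real.sin θ]}

/-- `{φ = 0}` is, up to a null set, a disk sector of opening angle in `(0, 2π)`. -/
def IsDiskSector (lam : ℝ) (φ : Plane → ℝ) : Prop :=
  ∃ θ₀ β : ℝ, 0 < β ∧ β < 2 * Real.pi ∧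
    {x | x ∈ disk lam ∧ φ x = 0} =ᵐ[volume] sector lam θ₀ β

/-- The annulus `A(a, b)` of inner radius `a` and outer radius `b` centred at the origin. -/
def annulus (a b : ℝ) : Set Plane := {x | a < ‖x‖ ∧ ‖x‖ < b}

/-- `{φ = 0}` is, up to a null set, a countable union of pairwise disjoint annuli in `𝒟`
centred at the origin. The annulus is empty if `a j = b j`, so finite unions are included. -/
def IsUnionOfAnnuli (lam : ℝ) (φ : Plane → ℝ) : Prop :=
  ∃ a b : ℕ → ℝ, (∀ j, 0 ≤ a j ∧ a j ≤ b j ∧ b j ≤ lam) ∧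
    (Pairwise fun i j => Disjoint (annulus (a i) (b i)) (annulus (a j) (b j))) ∧
    {x | x ∈ disk lam ∧ φ x = 0} =ᵐ[volume] ⋃ j, annulus (a j) (b j)

/-- `f(α) = (1 - α)^(3/4) (1 - √(1 - α))^(1/2)`. -/
def f (α : ℝ) : ℝ := (1 - α) ^ (3 / 4 : ℝ) * (1 - √(1 - α)) ^ (1 / 2 : ℝ)

end TwoBEC

end

/-! Both sides reduce to line integrals over the jump set. Since `∫ ρ = π λ⁴ / 2`, the normalisation
reads `π λ⁴ = 2`. A jump of height `π` along a radius of the disk costs `2σ ∫₀^λ (λ² - r²)^(3/2) dr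
= 2σ · 3πλ⁴/16 = 3σ/4`. A sector has two such sides, so it costs `8σ · 3/16` whatever its opening
angle, and the opening `2π α₁` meets the mass constraint (`energy_sector`,
`indicator_sector_mem_X`). Its variation measure is exhibited explicitly through Gauss–Green in
polar coordinates.

A jump along the circle of radius `r` costs `4πσ r (λ² - r²)^(3/2)`. If `m(r)` is the mass fraction
inside that circle, then `√(1 - m(r)) = 1 - r²/λ²`, and the cost becomes exactly `8σ f(m(r))`. A
radial `φ` is described by a set `E` of radii. Testing `Dφ` against radial fields shows that `|Dφ|`
gives mass at least `2π² r` to each circle whose radius lies in the essential boundary of `E`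
(`le_measure_sphere`). Local finiteness of `|Dφ|` then makes these radii locally finite in `(0, λ)`,
so `E` is open up to a null set: this is the union of annuli.

It remains to find boundary circles with `∑ f(m(r)) > 3/16`; one or two suffice. If some boundary
radius has mass fraction in `[δ, 1 - δ]`, the hypothesis on `f` applies directly. Otherwise the
half-mass radius lies in a maximal interval `(a, b)` of one phase, and the other phase, of mass at
least `δ`, must fit into the remaining mass `m(a) + (1 - m(b))`. Each summand is less than `δ`, so
both `a` and `b` are genuine boundary radii. As `f(u)/u` and `f(1 - u)/u` are nonincreasing, `δ
(f(m(a)) + f(m(b))) ≥ m(a) f(δ) + (1 - m(b)) f(1 - δ) > 3δ/16` (`exists_two_essBoundary`). -/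

noncomputable section

namespace TwoBEC

open MeasureTheory Set
open scoped ENNReal ContDiff

/-! ### Polar coordinates: integrals and null sets. -/

/-- Polar coordinates on the plane. -/
def polarMap (p : ℝ × ℝ) : Plane := !₂[p.1 * Real.cos p.2, p.1 * Real.sin p.2]

/-- The identification of `ℝ × ℝ` with the Euclidean plane. -/
def prodEquivPlane : ℝ × ℝ ≃ᵐ Plane :=
  MeasurableEquiv.finTwoArrow.symm.trans (MeasurableEquiv.toLp 2 (Fin 2 → ℝ))

theorem prodEquivPlane_apply (p : ℝ × ℝ) : prodEquivPlane p = !₂[p.1, p.2] := rfl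

theorem measurePreserving_prodEquivPlane : MeasurePreserving prodEquivPlane := by
  exact (PiLp.volume_preserving_toLp (Fin 2)).comp (volume_preserving_finTwoArrow ℝ).symm

theorem prodEquivPlane_polarCoord_symm (p : ℝ × ℝ) :
    prodEquivPlane (polarCoord.symm p) = polarMap p := by
  rw [prodEquivPlane_apply, polarMap, polarCoord_symm_apply]

theorem continuous_polarMap : Continuous polarMap := by
  unfold polarMap
  refine (PiLp.continuous_toLp 2 _).comp (continuous_pi fun i => ?_)
  fin_cases i <;> simp <;> fun_prop

theorem norm_polarMap (p : ℝ × ℝ) : ‖polarMap p‖ = |p.1| := by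
  rw [EuclideanSpace.norm_eq, ← Real.sqrt_sq_eq_abs]
  congr 1
  simp only [polarMap, Fin.sum_univ_two, Real.norm_eq_abs, sq_abs, PiLp.toLp_apply,
    Matrix.cons_val_zero, Matrix.cons_val_one]
  linear_combination p.1 ^ 2 * Real.sin_sq_add_cos_sq p.2

theorem exists_polarMap_eq (θ₀ : ℝ) (x : Plane) :
    ∃ θ ∈ Ico θ₀ (θ₀ + 2 * Real.pi), polarMap (‖x‖, θ) = x := by
  set z : ℂ := ⟨x 0, x 1⟩ with hz
  have hn : ‖x‖ = ‖z‖ := by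
    rw [EuclideanSpace.norm_eq, Complex.norm_def, Complex.normSq_apply]
    simp [Fin.sum_univ_two, hz, sq]
  refine ⟨toIcoMod Real.two_pi_pos θ₀ z.arg, toIcoMod_mem_Ico _ _ _, ?_⟩
  have h1 : Real.cos (toIcoMod Real.two_pi_pos θ₀ z.arg) = Real.cos z.arg := by
    rw [toIcoMod, zsmul_eq_mul, Real.cos_sub_int_mul_two_pi]
  have h2 : Real.sin (toIcoMod Real.two_pi_pos θ₀ z.arg) = Real.sin z.arg := by
    rw [toIcoMod, zsmul_eq_mul, Real.sin_sub_int_mul_two_pi]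
  ext i
  fin_cases i
  · change ‖x‖ * Real.cos _ = x 0
    rw [hn, h1, Complex.norm_mul_cos_arg]
  · change ‖x‖ * Real.sin _ = x 1
    rw [hn, h2, Complex.norm_mul_sin_arg]

theorem polarMap_eq_polarMap {r s θ τ : ℝ} (hr : 0 < r) (hs : 0 < s)
    (h : polarMap (r, θ) = polarMap (s, τ)) : r = s ∧ ∃ n : ℤ, θ - τ = n * (2 * Real.pi) := by
  have hrs : r = s := by
    have := congrArg norm h
    rwa [norm_polarMap, norm_polarMap, abs_of_pos hr, abs_of_pos hs] at this
  subst hrs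
  refine ⟨rfl, ?_⟩
  have hc : Real.cos θ = Real.cos τ := by
    have := congrArg (fun x : Plane => x 0) h
    simpa [polarMap, hr.ne'] using this
  have hsn : Real.sin θ = Real.sin τ := by
    have := congrArg (fun x : Plane => x 1) h
    simpa [polarMap, hr.ne'] using this
  have h1 : Real.cos (θ - τ) = 1 := by
    rw [Real.cos_sub, hc, hsn]; linear_combination Real.sin_sq_add_cos_sq τ
  obtain ⟨n, hn⟩ := (Real.cos_eq_one_iff _).1 h1
  exact ⟨n, hn.symm⟩

theorem injOn_polarMap {θ₀ β : ℝ} (hβ : β ≤ 2 * Real.pi) (s : Set ℝ) (hs : s ⊆ Ioi 0) :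
    InjOn polarMap (s ×ˢ Ioo θ₀ (θ₀ + β)) := by
  rintro ⟨r, θ⟩ ⟨hr, hθ⟩ ⟨t, τ⟩ ⟨ht, hτ⟩ h
  obtain ⟨rfl, n, hn⟩ := polarMap_eq_polarMap (hs hr) (hs ht) h
  simp only [mem_Ioo] at hθ hτ
  have hpi := Real.two_pi_pos
  have h1 : (n : ℝ) < 1 := by
    by_contra! hc
    nlinarith [hθ.2, hτ.1]
  have h2 : (-1 : ℝ) < n := by
    by_contra! hc
    nlinarith [hθ.1, hτ.2]
  have h0 : n = 0 := by
    have h1' : n < 1 := by exact_mod_cast h1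
    have h2' : -1 < n := by exact_mod_cast h2
    lia
  rw [h0, Int.cast_zero, zero_mul, sub_eq_zero] at hn
  rw [hn]

theorem sector_eq_image (lam θ₀ β : ℝ) :
    sector lam θ₀ β = polarMap '' (Ioo 0 lam ×ˢ Ioo θ₀ (θ₀ + β)) := by
  ext x
  constructor
  · rintro ⟨r, θ, h1, h2, h3, h4, rfl⟩
    exact ⟨(r, θ), ⟨⟨h1, h2⟩, h3, h4⟩, rfl⟩
  · rintro ⟨⟨r, θ⟩, ⟨⟨h1, h2⟩, h3, h4⟩, rfl⟩
    exact ⟨r, θ, h1, h2, h3, h4, rfl⟩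

theorem sector_eq_image_prod (lam θ₀ β : ℝ) :
    sector lam θ₀ β =
      prodEquivPlane '' (polarCoord.symm '' (Ioo 0 lam ×ˢ Ioo θ₀ (θ₀ + β))) := by
  rw [sector_eq_image, image_image]
  simp only [prodEquivPlane_polarCoord_symm]

theorem injOn_polarCoord_symm {θ₀ β : ℝ} (hβ : β ≤ 2 * Real.pi) (s : Set ℝ) (hs : s ⊆ Ioi 0) :
    InjOn polarCoord.symm (s ×ˢ Ioo θ₀ (θ₀ + β)) := fun p hp q hq h =>
  injOn_polarMap hβ s hs hp hq <| by
    rw [← prodEquivPlane_polarCoord_symm, ← prodEquivPlane_polarCoord_symm, h]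

theorem measurableSet_sector {lam θ₀ β : ℝ} (hβ : β ≤ 2 * Real.pi) :
    MeasurableSet (sector lam θ₀ β) := by
  rw [sector_eq_image_prod, prodEquivPlane.measurableSet_image]
  exact (measurableSet_Ioo.prod measurableSet_Ioo).image_of_continuousOn_injOn
    continuous_polarCoord_symm.continuousOn (injOn_polarCoord_symm hβ _ fun r hr => hr.1)

theorem setIntegral_sector {lam θ₀ β : ℝ} (hβ : β ≤ 2 * Real.pi) (F : Plane → ℝ) :
    ∫ x in sector lam θ₀ β, F x =
      ∫ p in Ioo 0 lam ×ˢ Ioo θ₀ (θ₀ + β), p.1 * F (polarMap p) := by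
  rw [sector_eq_image_prod, measurePreserving_prodEquivPlane.setIntegral_image_emb
    prodEquivPlane.measurableEmbedding,
    integral_image_eq_integral_abs_det_fderiv_smul volume
      (measurableSet_Ioo.prod measurableSet_Ioo)
      (fun p _ => (hasFDerivAt_polarCoord_symm p).hasFDerivWithinAt)
      (injOn_polarCoord_symm hβ _ fun r hr => hr.1)]
  refine setIntegral_congr_fun (measurableSet_Ioo.prod measurableSet_Ioo) fun p hp => ?_
  simp only [det_fderivPolarCoordSymm, prodEquivPlane_polarCoord_symm, smul_eq_mul,
    abs_of_pos hp.1.1]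

theorem ae_polarMap {P : Plane → Prop} (h : ∀ᵐ x, P x) :
    ∀ᵐ p : ℝ × ℝ, p ∈ polarCoord.target → P (polarMap p) := by
  rw [← measurePreserving_prodEquivPlane.map_eq,
    prodEquivPlane.measurableEmbedding.ae_map_iff] at h
  obtain ⟨t, ht, htm, ht0⟩ := exists_measurable_superset_of_null (ae_iff.1 h)
  have := lintegral_comp_polarCoord_symm (t.indicator 1)
  rw [lintegral_indicator_one htm, ht0, lintegral_eq_zero_iff', Filter.EventuallyEq,
    ae_restrict_iff' polarCoord.open_target.measurableSet] at this
  · filter_upwards [this] with p hp hpt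
    have h1 := hp hpt
    rw [← prodEquivPlane_polarCoord_symm]
    by_contra hc
    have h2 : polarCoord.symm p ∈ t := ht hc
    have h3 : 0 < p.1 := hpt.1
    rw [indicator_of_mem h2] at h1
    simp [h3.not_ge] at h1
  · refine Measurable.aemeasurable ?_
    refine (measurable_fst.ennreal_ofReal).smul ?_
    exact (measurable_one.indicator htm).comp continuous_polarCoord_symm.measurable

theorem ae_norm_of_ae {P : ℝ → Prop} (h : ∀ᵐ r : ℝ, 0 < r → P r) :
    ∀ᵐ x : Plane, P ‖x‖ := by
  obtain ⟨t, ht, htm, ht0⟩ := exists_measurable_superset_of_null (ae_iff.1 h)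
  have h1 : ∀ᵐ x : Plane, ‖x‖ ∉ t := by
    rw [ae_iff]
    have hm : MeasurableSet {x : Plane | ‖x‖ ∈ t} := measurable_norm htm
    simp only [not_not]
    have h2 : ∫⁻ p in polarCoord.target, ENNReal.ofReal p.1 •
        ((prodEquivPlane ⁻¹' {x : Plane | ‖x‖ ∈ t}).indicator 1 (polarCoord.symm p) : ℝ≥0∞) = 0 := by
      rw [lintegral_eq_zero_iff', Filter.EventuallyEq,
        ae_restrict_iff' polarCoord.open_target.measurableSet]
      · have h3 : ∀ᵐ p : ℝ × ℝ, p.1 ∉ t := by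
          have : ∀ᵐ r : ℝ, r ∉ t := by rw [ae_iff]; simpa using ht0
          exact Measure.quasiMeasurePreserving_fst.ae this
        filter_upwards [h3] with p hp hpt
        have h4 : 0 < p.1 := hpt.1
        have h5 : polarCoord.symm p ∉ prodEquivPlane ⁻¹' {x : Plane | ‖x‖ ∈ t} := by
          rw [mem_preimage, prodEquivPlane_polarCoord_symm, mem_ofPred_eq, norm_polarMap,
            abs_of_pos h4]
          exact hp
        rw [indicator_of_notMem h5, smul_zero, Pi.zero_apply]
      · refine Measurable.aemeasurable ?_
        refine (measurable_fst.ennreal_ofReal).smul ?_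
        exact (measurable_one.indicator (prodEquivPlane.measurable hm)).comp
          continuous_polarCoord_symm.measurable
    rw [lintegral_comp_polarCoord_symm, lintegral_indicator_one (prodEquivPlane.measurable hm),
      measurePreserving_prodEquivPlane.measure_preimage_equiv] at h2
    exact h2
  have h0 : ∀ᵐ x : Plane, x ≠ 0 := by simp [ae_iff]
  filter_upwards [h1, h0] with x hx hx0
  by_contra hc
  exact hx (ht fun h => hc (h (norm_pos_iff.2 hx0)))

theorem integral_norm_eq (F : ℝ → ℝ) :
    ∫ x : Plane, F ‖x‖ = 2 * Real.pi * ∫ r in Ioi (0 : ℝ), r * F r := by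
  rw [integral_fun_norm_addHaar, measureReal_def, EuclideanSpace.volume_ball_fin_two]
  simp [ENNReal.toReal_ofReal Real.pi_pos.le]
  ring

theorem setIntegral_disk_norm_eq {lam : ℝ} (F : ℝ → ℝ) :
    ∫ x in disk lam, F ‖x‖ = 2 * Real.pi * ∫ r in Ioo 0 lam, r * F r := by
  have h := integral_norm_eq ((Iio lam).indicator F)
  rw [← integral_indicator (show MeasurableSet (disk lam) from measurableSet_ball)]
  have e : (fun x : Plane => (Iio lam).indicator F ‖x‖) =
      (disk lam).indicator (fun x : Plane => F ‖x‖) := by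
    funext x
    simp [indicator, disk]
  rw [← e, h]
  congr 1
  have e2 : (fun r => r * (Iio lam).indicator F r) = (Iio lam).indicator (fun r => r * F r) := by
    funext r
    simp [indicator]
  rw [e2, setIntegral_indicator measurableSet_Iio, Ioi_inter_Iio]

theorem isOpen_disk (lam : ℝ) : IsOpen (disk lam) := Metric.isOpen_ball

theorem measurableSet_disk (lam : ℝ) : MeasurableSet (disk lam) := measurableSet_ball

theorem mem_disk {lam : ℝ} {x : Plane} : x ∈ disk lam ↔ ‖x‖ < lam := by
  simp [disk]

/-! ### Radial functions as sets of radii. -/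

/-- In the disk, `φ` is `0` at the radii in `E` and `π` at the other radii, up to a null set. -/
def IsProfile (lam : ℝ) (E : Set ℝ) (φ : Plane → ℝ) : Prop :=
  MeasurableSet E ∧
    ∀ᵐ x : Plane, x ∈ disk lam → φ x = (Eᶜ.indicator (fun _ => Real.pi) ‖x‖)

/-- The function `g` witnessing radial symmetry need not be measurable. By Fubini it agrees, along
almost every ray, with a measurable representative of `φ`, and `E` is the zero set of that
representative on one such ray. -/
theorem exists_isProfile {lam : ℝ} {φ : Plane → ℝ}
    (hm : AEStronglyMeasurable φ (volume.restrict (disk lam)))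
    (hv : ∀ᵐ x ∂(volume.restrict (disk lam)), φ x = 0 ∨ φ x = Real.pi)
    (hr : IsRadial lam φ) : ∃ E, IsProfile lam E φ := by
  obtain ⟨g, hg⟩ := hr
  have hall := (hm.ae_eq_mk.and hv).and hg
  rw [ae_restrict_iff' (measurableSet_disk lam)] at hall
  set φ' := hm.mk φ
  have hφ' : Measurable φ' := hm.stronglyMeasurable_mk.measurable
  have h1 := ae_polarMap hall
  -- The coordinates are swapped so that Fubini yields almost every angle first, then almost every
  -- radius.
  have h2 : ∀ᵐ p : ℝ × ℝ, p.swap ∈ polarCoord.target → polarMap p.swap ∈ disk lam →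
      (φ (polarMap p.swap) = φ' (polarMap p.swap) ∧
        (φ (polarMap p.swap) = 0 ∨ φ (polarMap p.swap) = Real.pi)) ∧
        φ (polarMap p.swap) = g ‖polarMap p.swap‖ :=
    (Measure.measurePreserving_swap (μ := (volume : Measure ℝ))
      (ν := (volume : Measure ℝ))).quasiMeasurePreserving.ae h1
  have h3 := Measure.ae_ae_of_ae_prod h2
  have h4 : ∃ θ ∈ Ioo (-Real.pi) Real.pi, ∀ᵐ r : ℝ, 0 < r → r < lam →
      (g r = 0 ∨ g r = Real.pi) ∧ g r = φ' (polarMap (r, θ)) := by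
    have h5 : ∀ᵐ θ ∂(volume.restrict (Ioo (-Real.pi) Real.pi)), ∀ᵐ r : ℝ, 0 < r → r < lam →
        (g r = 0 ∨ g r = Real.pi) ∧ g r = φ' (polarMap (r, θ)) := by
      rw [ae_restrict_iff' measurableSet_Ioo]
      filter_upwards [h3] with θ hθ hθm
      filter_upwards [hθ] with r hr h0 hl
      have hn : ‖polarMap (r, θ)‖ = r := by rw [norm_polarMap, abs_of_pos h0]
      obtain ⟨⟨h6, h7⟩, h8⟩ := hr ⟨h0, hθm⟩ (mem_disk.2 (by simpa [hn] using hl))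
      simp only [Prod.swap_prod_mk] at h6 h7 h8
      rw [hn] at h8
      rw [← h8, ← h6]
      exact ⟨h7, rfl⟩
    have : (volume.restrict (Ioo (-Real.pi) Real.pi)) ≠ 0 := by
      rw [Ne, Measure.restrict_eq_zero, Real.volume_Ioo]
      simp [Real.pi_pos]
    have : (ae (volume.restrict (Ioo (-Real.pi) Real.pi))).NeBot := ae_neBot.2 this
    obtain ⟨θ, h6, h7⟩ := (h5.and (ae_restrict_mem measurableSet_Ioo)).exists
    exact ⟨θ, h7, h6⟩
  obtain ⟨θ, -, hθ⟩ := h4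
  refine ⟨{r | φ' (polarMap (r, θ)) = 0}, ?_, ?_⟩
  · have : Measurable fun r : ℝ => φ' (polarMap (r, θ)) :=
      hφ'.comp (continuous_polarMap.measurable.comp (measurable_id.prodMk measurable_const))
    exact this (measurableSet_singleton 0)
  · filter_upwards [ae_norm_of_ae hθ, hall, (by simp [ae_iff] : ∀ᵐ x : Plane, x ≠ 0)]
      with x hx hx2 hx0 hxd
    obtain ⟨h5, h6⟩ := hx (mem_disk.1 hxd)
    rw [(hx2 hxd).2]
    by_cases h0 : g ‖x‖ = 0
    · simp [indicator, ← h6, h0]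
    · simp [indicator, ← h6, h0]
      exact h5.resolve_left h0

/-! ### Radial test fields and lower bounds for the variation of annuli. -/

/-- The radial field `h(|x|) x / |x|²`. -/
def radialField (h : ℝ → ℝ) (x : Plane) : Plane := (h ‖x‖ / ‖x‖ ^ 2) • x

theorem divergence_smul_id {F : Plane → ℝ} {F' : Plane →L[ℝ] ℝ} {x : Plane}
    (hF : HasFDerivAt F F' x) : divergence (fun y => F y • y) x = 2 * F x + F' x := by
  have h := (hF.smul (hasFDerivAt_id x)).fderiv
  unfold divergence
  have e : fderiv ℝ (fun y => F y • y) x = _ := h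
  rw [e]
  have hx : F' x = x 0 * F' (EuclideanSpace.single 0 1) + x 1 * F' (EuclideanSpace.single 1 1) := by
    have : x = x 0 • EuclideanSpace.single 0 1 + x 1 • EuclideanSpace.single 1 1 := by
      ext i; fin_cases i <;> simp
    conv_lhs => rw [this]
    simp
  rw [hx, Fin.sum_univ_two]
  simp
  ring

section RadialField

variable {h : ℝ → ℝ} {a b : ℝ}

theorem radialField_eq_zero (hs : ∀ r, r ∉ Ioo a b → h r = 0) {x : Plane}
    (hx : x ∉ annulus a b) : radialField h x = 0 := by
  rw [radialField, hs _ hx, zero_div, zero_smul]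

theorem isTestField_radialField {lam : ℝ} (hh : ContDiff ℝ ∞ h) (ha : 0 < a) (hb : b < lam)
    (hs : ∀ r, r ∉ Ioo a b → h r = 0) : IsTestField (disk lam) (radialField h) := by
  have hsupp : tsupport (radialField h) ⊆ Metric.closedBall 0 b := by
    refine closure_minimal (fun x hx => ?_) Metric.isClosed_closedBall
    by_contra hc
    rw [mem_closedBall_zero_iff, not_le] at hc
    exact hx (radialField_eq_zero hs fun hm => hc.not_gt hm.2)
  refine ⟨?_, HasCompactSupport.of_support_subset_isCompact (isCompact_closedBall 0 b)
    (subset_closure.trans hsupp), hsupp.trans (Metric.closedBall_subset_ball hb)⟩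
  rw [contDiff_iff_contDiffAt]
  intro x
  by_cases hx : x = 0
  -- Since `h` vanishes below `a > 0`, the singularity of `x / |x|²` at the origin is not seen.
  · have hz : radialField h =ᶠ[nhds x] fun _ => 0 := by
      have : ∀ᶠ y : Plane in nhds x, ‖y‖ < a := by
        refine continuous_norm.continuousAt.eventually_lt continuousAt_const ?_
        simpa [hx] using ha
      filter_upwards [this] with y hy
      exact radialField_eq_zero hs fun hm => hy.not_gt hm.1
    exact contDiffAt_const.congr_of_eventuallyEq hz
  · have h1 : ContDiffAt ℝ ∞ (fun y : Plane => ‖y‖) x := contDiffAt_norm ℝ hx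
    exact ((hh.contDiffAt.comp x h1).div (h1.pow 2)
      (pow_ne_zero 2 (norm_ne_zero_iff.2 hx))).smul contDiffAt_id

/-- In the plane `x / |x|²` is divergence free off the origin, so only the derivative of `h`
survives. The remaining factor `1 / |x|` cancels the polar Jacobian, which turns the pairing with
`Dφ` into a one-dimensional one. -/
theorem divergence_radialField (hh : ContDiff ℝ ∞ h) {x : Plane} (hx : x ≠ 0) :
    divergence (radialField h) x = deriv h ‖x‖ / ‖x‖ := by
  have hn : ‖x‖ ≠ 0 := norm_ne_zero_iff.2 hx
  have h1 : HasFDerivAt (fun y : Plane => ‖y‖) (fderiv ℝ (fun y : Plane => ‖y‖) x) x :=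
    ((contDiffAt_norm ℝ hx).differentiableAt (n := 1) (by simp)).hasFDerivAt
  have h2 : HasDerivAt (fun r => h r / r ^ 2)
      ((deriv h ‖x‖ * ‖x‖ ^ 2 - h ‖x‖ * (2 * ‖x‖)) / (‖x‖ ^ 2) ^ 2) ‖x‖ := by
    have h3 := (hh.differentiable (by simp) ‖x‖).hasDerivAt
    have h4 : HasDerivAt (fun r : ℝ => r ^ 2) (2 * ‖x‖) ‖x‖ := by
      simpa using hasDerivAt_pow 2 ‖x‖
    exact h3.div h4 (pow_ne_zero 2 hn)
  have h5 := divergence_smul_id (h2.comp_hasFDerivAt x h1)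
  change divergence (fun y : Plane => (h ‖y‖ / ‖y‖ ^ 2) • y) x = _
  refine h5.trans ?_
  have h6 : fderiv ℝ (fun y : Plane => ‖y‖) x x = ‖x‖ :=
    DifferentiableAt.fderiv_norm_self h1.differentiableAt
  simp only [Function.comp, smul_apply, h6, smul_eq_mul]
  field_simp
  ring

theorem setIntegral_mul_divergence_radialField {lam : ℝ} {E : Set ℝ} {φ : Plane → ℝ}
    (hE : IsProfile lam E φ) (hh : ContDiff ℝ ∞ h) :
    ∫ x in disk lam, φ x * divergence (radialField h) x =
      2 * Real.pi * ∫ r in Ioo 0 lam, Eᶜ.indicator (fun _ => Real.pi) r * deriv h r := by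
  have h1 : ∫ x in disk lam, φ x * divergence (radialField h) x =
      ∫ x in disk lam, (fun r => Eᶜ.indicator (fun _ => Real.pi) r * (deriv h r / r)) ‖x‖ := by
    refine setIntegral_congr_ae (measurableSet_disk lam) ?_
    filter_upwards [hE.2, (by simp [ae_iff] : ∀ᵐ x : Plane, x ≠ 0)] with x hx hx0 hxd
    rw [hx hxd, divergence_radialField hh hx0]
  rw [h1, setIntegral_disk_norm_eq fun r => Eᶜ.indicator (fun _ => Real.pi) r * (deriv h r / r)]
  congr 1
  refine setIntegral_congr_fun measurableSet_Ioo fun r hr => ?_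
  have : r ≠ 0 := hr.1.ne'
  field_simp

theorem measurableSet_annulus (a b : ℝ) : MeasurableSet (annulus a b) :=
  measurable_norm measurableSet_Ioo

theorem measure_annulus_lt_top {lam : ℝ} {φ : Plane → ℝ} {μ : Measure Plane}
    (hμ : IsVariationMeasure (disk lam) φ μ) (hb : b < lam) : μ (annulus a b) < ⊤ := by
  refine (measure_mono ?_).trans_lt (hμ.finite_on_compacts (Metric.closedBall 0 b)
    (isCompact_closedBall 0 b) (Metric.closedBall_subset_ball hb))
  intro x hx
  exact mem_closedBall_zero_iff.2 hx.2.le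

/-- The field `radialField h` is an admissible test field supported in the annulus, with norm `|h| /
|x| ≤ 1 / a` there; the polar decomposition of `Dφ` bounds the pairing by `μ (annulus a b) / a`. -/
theorem abs_integral_mul_deriv_le {lam : ℝ} {E : Set ℝ} {φ : Plane → ℝ} {μ : Measure Plane}
    (hμ : IsVariationMeasure (disk lam) φ μ) (hE : IsProfile lam E φ)
    (hh : ContDiff ℝ ∞ h) (ha : 0 < a) (hb : b < lam) (hs : ∀ r, r ∉ Ioo a b → h r = 0)
    (h1 : ∀ r, |h r| ≤ 1) :
    2 * Real.pi * a * |∫ r in Ioo 0 lam, Eᶜ.indicator (fun _ => Real.pi) r * deriv h r| ≤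
      (μ (annulus a b)).toReal := by
  obtain ⟨ν, hν, hν1, hdiv⟩ := hμ.polar
  have e := hdiv _ (isTestField_radialField hh ha hb hs)
  rw [setIntegral_mul_divergence_radialField hE hh] at e
  have hz : ∀ x, x ∉ annulus a b → inner ℝ (radialField h x) (ν x) = 0 := fun x hx => by
    rw [radialField_eq_zero hs hx, inner_zero_left]
  rw [← setIntegral_eq_integral_of_forall_compl_eq_zero hz] at e
  have hle : ‖∫ x in annulus a b, inner ℝ (radialField h x) (ν x) ∂μ‖ ≤
      1 / a * μ.real (annulus a b) := by
    refine norm_setIntegral_le_of_norm_le_const_ae' (measure_annulus_lt_top hμ hb) ?_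
    filter_upwards [hν1] with x hx hxa
    refine (norm_inner_le_norm _ _).trans ?_
    rw [hx, mul_one, radialField, norm_smul, Real.norm_eq_abs, abs_div, abs_of_nonneg (sq_nonneg ‖x‖)]
    have hn : 0 < ‖x‖ := ha.trans hxa.1
    have : |h ‖x‖| / ‖x‖ ^ 2 * ‖x‖ = |h ‖x‖| / ‖x‖ := by field_simp
    rw [this]
    exact div_le_div₀ zero_le_one (h1 _) ha hxa.1.le
  have e2 := congrArg abs e
  rw [abs_neg, abs_mul, abs_of_pos Real.two_pi_pos] at e2
  rw [Real.norm_eq_abs, ← e2, one_div, measureReal_def] at hle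
  calc _ = a * (2 * Real.pi * |∫ r in Ioo 0 lam,
        Eᶜ.indicator (fun _ => Real.pi) r * deriv h r|) := by ring
    _ ≤ a * (a⁻¹ * (μ (annulus a b)).toReal) := mul_le_mul_of_nonneg_left hle ha.le
    _ = _ := by field_simp

end RadialField

/-- The primitive of the difference of two densities on `(a, b)` is an admissible test function. -/
theorem abs_integral_sub_integral_le {lam : ℝ} {E : Set ℝ} {φ : Plane → ℝ} {μ : Measure Plane}
    (hμ : IsVariationMeasure (disk lam) φ μ) (hE : IsProfile lam E φ) {a b : ℝ}
    (ha : 0 < a) (hab : a < b) (hb : b < lam) {η₁ η₂ : ℝ → ℝ}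
    (h₁ : ContDiff ℝ ∞ η₁) (h₂ : ContDiff ℝ ∞ η₂) (n₁ : ∀ r, 0 ≤ η₁ r) (n₂ : ∀ r, 0 ≤ η₂ r)
    (s₁ : ∀ r, r ∉ Ioo a b → η₁ r = 0) (s₂ : ∀ r, r ∉ Ioo a b → η₂ r = 0)
    (i₁ : ∫ r, η₁ r = 1) (i₂ : ∫ r, η₂ r = 1) :
    2 * Real.pi * a * |(∫ r, η₁ r * Eᶜ.indicator (fun _ => Real.pi) r) -
      ∫ r, η₂ r * Eᶜ.indicator (fun _ => Real.pi) r| ≤ (μ (annulus a b)).toReal := by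
  have key : ∀ η : ℝ → ℝ, ContDiff ℝ ∞ η → (∀ r, 0 ≤ η r) → (∀ r, r ∉ Ioo a b → η r = 0) →
      ∫ r, η r = 1 → (∀ t, 0 ≤ ∫ r in a..t, η r ∨ t ≤ a) ∧ (∀ t, t ≤ a → ∫ r in a..t, η r = 0) ∧
      (∀ t, b ≤ t → ∫ r in a..t, η r = 1) ∧ (∀ t, ∫ r in a..t, η r ≤ 1) ∧
      Integrable (fun r => η r * Eᶜ.indicator (fun _ => Real.pi) r) := by
    intro η hη hn hs hi
    have hint : Integrable η := hη.continuous.integrable_of_hasCompactSupport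
      (HasCompactSupport.intro isCompact_Icc fun x hx => hs x fun h => hx (Ioo_subset_Icc_self h))
    have hle : ∀ t, t ≤ a → ∫ r in a..t, η r = 0 := fun t ht => by
      refine intervalIntegral.integral_zero_ae (Filter.Eventually.of_forall fun r hr => hs r ?_)
      rw [uIoc_of_ge ht] at hr
      exact fun hm => hm.1.not_ge hr.2
    refine ⟨fun t => ?_, hle, fun t ht => ?_, fun t => ?_, ?_⟩
    · rcases le_total t a with h | h
      · exact Or.inr h
      · exact Or.inl (intervalIntegral.integral_nonneg h fun r _ => hn r)
    · rw [intervalIntegral.integral_of_le (hab.le.trans ht), ← hi]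
      refine setIntegral_eq_integral_of_forall_compl_eq_zero fun r hr => hs r fun hm => hr ?_
      exact ⟨hm.1, hm.2.le.trans ht⟩
    · rcases le_total t a with h | h
      · rw [hle t h]; exact zero_le_one
      · rw [intervalIntegral.integral_of_le h, ← hi]
        exact setIntegral_le_integral hint (Filter.Eventually.of_forall hn)
    · refine hint.mul_bdd (c := Real.pi)
        ((measurable_const.indicator hE.1.compl).aestronglyMeasurable) (Filter.Eventually.of_forall ?_)
      intro r
      by_cases hr : r ∈ Eᶜ
      · rw [indicator_of_mem hr, Real.norm_of_nonneg Real.pi_pos.le]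
      · rw [indicator_of_notMem hr, norm_zero]; exact Real.pi_pos.le
  obtain ⟨p₁, z₁, o₁, l₁, g₁⟩ := key η₁ h₁ n₁ s₁ i₁
  obtain ⟨p₂, z₂, o₂, l₂, g₂⟩ := key η₂ h₂ n₂ s₂ i₂
  -- Each primitive rises from `0` at `a` to `1` at `b`, so their difference vanishes outside `(a,
  -- b)` and stays between `-1` and `1`.
  set h : ℝ → ℝ := fun t => (∫ r in a..t, η₁ r) - ∫ r in a..t, η₂ r with hh
  have hd : ∀ t, HasDerivAt h (η₁ t - η₂ t) t := fun t =>
    (h₁.continuous.integral_hasStrictDerivAt a t).hasDerivAt.sub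
      (h₂.continuous.integral_hasStrictDerivAt a t).hasDerivAt
  have hderiv : deriv h = fun t => η₁ t - η₂ t := funext fun t => (hd t).deriv
  have hsm : ContDiff ℝ ∞ h := by
    rw [contDiff_infty_iff_deriv]
    refine ⟨fun t => (hd t).differentiableAt, ?_⟩
    rw [hderiv]
    exact h₁.sub h₂
  have hs : ∀ r, r ∉ Ioo a b → h r = 0 := by
    intro r hr
    rcases le_or_gt r a with hra | hra
    · simp only [hh, z₁ r hra, z₂ r hra, sub_zero]
    · have hbr : b ≤ r := not_lt.1 fun h' => hr ⟨hra, h'⟩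
      simp only [hh, o₁ r hbr, o₂ r hbr, sub_self]
  have hb1 : ∀ r, |h r| ≤ 1 := by
    intro r
    rcases p₁ r with h1 | h1
    · rcases p₂ r with h2 | h2
      · rw [abs_le]
        constructor <;> simp only [hh] <;> linarith [l₁ r, l₂ r]
      · simp only [hh, z₁ r h2, z₂ r h2]; simp
    · simp only [hh, z₁ r h1, z₂ r h1]; simp
  have hfin := abs_integral_mul_deriv_le hμ hE hsm ha hb hs hb1
  have e : ∫ r in Ioo 0 lam, Eᶜ.indicator (fun _ => Real.pi) r * deriv h r =
      (∫ r, η₁ r * Eᶜ.indicator (fun _ => Real.pi) r) -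
      ∫ r, η₂ r * Eᶜ.indicator (fun _ => Real.pi) r := by
    rw [← integral_sub g₁ g₂, setIntegral_eq_integral_of_forall_compl_eq_zero]
    · rw [hderiv]
      exact integral_congr_ae (Filter.Eventually.of_forall fun r => by ring)
    · intro r hr
      have hr' : r ∉ Ioo a b := fun hm => hr ⟨ha.trans hm.1, hm.2.trans hb⟩
      rw [hderiv]
      simp only [s₁ r hr', s₂ r hr', sub_self, mul_zero]
  rwa [e] at hfin

/-- Across radii in `(a, b)` at which `φ` takes both values, `|Dφ|` charges the annulus. -/
theorem le_measure_annulus {lam : ℝ} {E : Set ℝ} {φ : Plane → ℝ} {μ : Measure Plane}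
    (hμ : IsVariationMeasure (disk lam) φ μ) (hE : IsProfile lam E φ) {a b : ℝ}
    (ha : 0 < a) (hb : b < lam) (h0 : volume (E ∩ Ioo a b) ≠ 0) (h1 : volume (Eᶜ ∩ Ioo a b) ≠ 0) :
    ENNReal.ofReal (2 * Real.pi ^ 2 * a) ≤ μ (annulus a b) := by
  set g : ℝ → ℝ := Eᶜ.indicator (fun _ => Real.pi) with hg
  have hgl : LocallyIntegrable g := by
    have : LocallyIntegrable (fun _ : ℝ => Real.pi) := locallyIntegrable_const _
    exact this.indicator hE.1.compl
  -- The outer radius is always twice the inner one: convergence of the mollifications at almost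
  -- every point needs a bounded ratio, here `K = 2`.
  let B : ℕ → ContDiffBump (0 : ℝ) := fun n =>
    ⟨1 / (n + 1) / 2, 1 / (n + 1), by positivity, half_lt_self (by positivity)⟩
  have hB0 : Filter.Tendsto (fun n => (B n).rOut) Filter.atTop (nhds 0) :=
    tendsto_one_div_add_atTop_nhds_zero_nat
  have hlim := ContDiffBump.ae_convolution_tendsto_right_of_locallyIntegrable (K := 2)
    hB0 (Filter.Eventually.of_forall fun n => by
      change 1 / ((n : ℝ) + 1) ≤ 2 * (1 / ((n : ℝ) + 1) / 2)
      linarith) hgl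
  simp only [convolution_eq_swap, ContinuousLinearMap.lsmul_apply, smul_eq_mul] at hlim
  -- Mollification converges almost everywhere, hence at some point of any set of positive measure.
  have pick : ∀ S : Set ℝ, volume (S ∩ Ioo a b) ≠ 0 → ∃ x ∈ S ∩ Ioo a b, Filter.Tendsto
      (fun n => ∫ t, (B n).normed volume (x - t) * g t) Filter.atTop (nhds (g x)) := by
    intro S hS
    by_contra! hc
    exact hS (measure_mono_null (fun x hx => hc x hx) (ae_iff.1 hlim))
  obtain ⟨x, ⟨hxE, hx⟩, hxl⟩ := pick E h0
  obtain ⟨y, ⟨hyE, hy⟩, hyl⟩ := pick Eᶜ h1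
  rw [hg, indicator_of_notMem (by simpa using hxE), ← hg] at hxl
  rw [hg, indicator_of_mem hyE, ← hg] at hyl
  have hprop : ∀ z ∈ Ioo a b, ∀ᶠ n in Filter.atTop,
      ContDiff ℝ ∞ (fun t => (B n).normed volume (z - t)) ∧
      (∀ r, 0 ≤ (B n).normed volume (z - r)) ∧
      (∀ r, r ∉ Ioo a b → (B n).normed volume (z - r) = 0) ∧
      ∫ r, (B n).normed volume (z - r) = 1 := by
    intro z hz
    have hev : ∀ᶠ n in Filter.atTop, (B n).rOut < min (z - a) (b - z) :=
      hB0.eventually_lt_const (lt_min (sub_pos.2 hz.1) (sub_pos.2 hz.2))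
    filter_upwards [hev] with n hn
    refine ⟨(B n).contDiff_normed.comp (contDiff_const.sub contDiff_id),
      fun r => (B n).nonneg_normed _, fun r hr => ?_, ?_⟩
    · by_contra hc
      have hm : z - r ∈ Function.support ((B n).normed volume) := hc
      rw [(B n).support_normed_eq, mem_ball_zero_iff, Real.norm_eq_abs, abs_lt] at hm
      have := min_le_left (z - a) (b - z)
      have := min_le_right (z - a) (b - z)
      exact hr ⟨by linarith [hm.2], by linarith [hm.1]⟩
    · rw [integral_sub_left_eq_self (fun t => (B n).normed volume t) volume z]
      exact (B n).integral_normed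
  have hab : a < b := hx.1.trans hx.2
  have hev : ∀ᶠ n in Filter.atTop, 2 * Real.pi * a *
      |(∫ t, (B n).normed volume (y - t) * g t) - ∫ t, (B n).normed volume (x - t) * g t| ≤
        (μ (annulus a b)).toReal := by
    filter_upwards [hprop x hx, hprop y hy] with n hnx hny
    exact abs_integral_sub_integral_le hμ hE ha hab hb hny.1 hnx.1 hny.2.1 hnx.2.1 hny.2.2.1
      hnx.2.2.1 hny.2.2.2 hnx.2.2.2
  -- In the limit the averages become the values `π` at `y` and `0` at `x`, so the full jump `π` is
  -- recovered.
  have hfin := le_of_tendsto (((hyl.sub hxl).abs).const_mul (2 * Real.pi * a)) hev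
  rw [sub_zero, abs_of_pos Real.pi_pos] at hfin
  refine ENNReal.ofReal_le_of_le_toReal (le_trans (le_of_eq ?_) hfin)
  ring

/-! ### Essential interior and boundary of the set of radii. -/

/-- The points near which `E` has full measure. -/
def essInterior (E : Set ℝ) : Set ℝ := {r | ∃ a b, r ∈ Ioo a b ∧ volume (Eᶜ ∩ Ioo a b) = 0}

/-- The points near which neither `E` nor its complement is a null set. -/
def essBoundary (E : Set ℝ) : Set ℝ := (essInterior E ∪ essInterior Eᶜ)ᶜ

theorem isOpen_essInterior (E : Set ℝ) : IsOpen (essInterior E) := by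
  rw [isOpen_iff_mem_nhds]
  rintro r ⟨a, b, hr, h⟩
  filter_upwards [Ioo_mem_nhds hr.1 hr.2] with s hs
  exact ⟨a, b, hs, h⟩

theorem disjoint_essInterior (E : Set ℝ) : Disjoint (essInterior E) (essInterior Eᶜ) := by
  rw [disjoint_left]
  rintro r ⟨a, b, hr, h⟩ ⟨c, d, hr', h'⟩
  rw [compl_compl] at h'
  have h0 : volume (Ioo (max a c) (min b d)) = 0 := by
    refine measure_mono_null (fun x hx => ?_) (measure_union_null h h')
    have h1 : x ∈ Ioo a b := ⟨(le_max_left _ _).trans_lt hx.1, hx.2.trans_le (min_le_left _ _)⟩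
    have h2 : x ∈ Ioo c d := ⟨(le_max_right _ _).trans_lt hx.1, hx.2.trans_le (min_le_right _ _)⟩
    by_cases hxE : x ∈ E
    · exact Or.inr ⟨hxE, h2⟩
    · exact Or.inl ⟨hxE, h1⟩
  rw [Real.volume_Ioo, ENNReal.ofReal_eq_zero] at h0
  have := max_lt hr.1 hr'.1
  have := lt_min hr.2 hr'.2
  linarith

theorem volume_essInterior_diff (E : Set ℝ) : volume (essInterior E \ E) = 0 := by
  refine measure_null_of_locally_null _ ?_
  rintro r ⟨⟨a, b, hr, h⟩, -⟩
  refine ⟨Eᶜ ∩ Ioo a b, ?_, h⟩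
  refine mem_nhdsWithin.2 ⟨Ioo a b, isOpen_Ioo, hr, ?_⟩
  rintro s ⟨hs, -, hsE⟩
  exact ⟨hsE, hs⟩

theorem volume_ne_zero_of_mem_essBoundary {E : Set ℝ} {r a b : ℝ} (hr : r ∈ essBoundary E)
    (hab : r ∈ Ioo a b) : volume (E ∩ Ioo a b) ≠ 0 ∧ volume (Eᶜ ∩ Ioo a b) ≠ 0 := by
  refine ⟨fun h => hr (Or.inr ⟨a, b, hab, by rwa [compl_compl]⟩), fun h => hr (Or.inl ⟨a, b, hab, h⟩)⟩

theorem essBoundary_compl (E : Set ℝ) : essBoundary Eᶜ = essBoundary E := by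
  rw [essBoundary, essBoundary, compl_compl, union_comm]

section Profile

variable {lam : ℝ} {E : Set ℝ} {φ : Plane → ℝ} {μ : Measure Plane}

/-- Both phases have positive measure in every interval around `r`, so `le_measure_annulus` applies
to annuli shrinking to the circle, and continuity from above passes to the limit. -/
theorem le_measure_sphere (hμ : IsVariationMeasure (disk lam) φ μ) (hE : IsProfile lam E φ)
    {r : ℝ} (hr : r ∈ essBoundary E) (h0 : 0 < r) (hl : r < lam) :
    ENNReal.ofReal (2 * Real.pi ^ 2 * r) ≤ μ (Metric.sphere 0 r) := by
  -- The shift by `2` keeps the radii strictly between `0` and `lam` already for `n = 0`.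
  set ε : ℕ → ℝ := fun n => min r (lam - r) / (n + 2) with hε
  have hm : 0 < min r (lam - r) := lt_min h0 (sub_pos.2 hl)
  have hpos : ∀ n, 0 < ε n := fun n => by positivity
  have hlt : ∀ n, ε n < min r (lam - r) := fun n => by
    refine div_lt_self hm ?_
    have : (0 : ℝ) ≤ n := n.cast_nonneg
    linarith
  have hanti : Antitone ε := fun m n hmn => by
    refine div_le_div_of_nonneg_left hm.le (by positivity) ?_
    have : (m : ℝ) ≤ n := by exact_mod_cast hmn
    linarith
  have hlim : Filter.Tendsto ε Filter.atTop (nhds 0) := by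
    refine tendsto_const_nhds.div_atTop ?_
    exact Filter.tendsto_atTop_add_const_right _ _ tendsto_natCast_atTop_atTop
  have hsphere : Metric.sphere (0 : Plane) r = ⋂ n, annulus (r - ε n) (r + ε n) := by
    ext x
    rw [mem_sphere_zero_iff_norm, mem_iInter]
    constructor
    · intro h n
      exact ⟨by linarith [hpos n], by linarith [hpos n]⟩
    · intro h
      have h1 : r - 0 ≤ ‖x‖ := le_of_tendsto (hlim.const_sub r)
        (Filter.Eventually.of_forall fun n => (h n).1.le)
      have h2 : ‖x‖ ≤ r + 0 := ge_of_tendsto (hlim.const_add r)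
        (Filter.Eventually.of_forall fun n => (h n).2.le)
      linarith
  rw [hsphere]
  have h1 := tendsto_measure_iInter_atTop (μ := μ)
    (s := fun n => annulus (r - ε n) (r + ε n))
    (fun n => (measurableSet_annulus _ _).nullMeasurableSet)
    (fun m n hmn x hx => ⟨by linarith [hanti hmn, hx.1], by linarith [hanti hmn, hx.2]⟩)
    ⟨0, (measure_annulus_lt_top hμ (by
      have := hlt 0; have := min_le_right r (lam - r); linarith)).ne⟩
  have h2 : Filter.Tendsto (fun n => ENNReal.ofReal (2 * Real.pi ^ 2 * (r - ε n))) Filter.atTop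
      (nhds (ENNReal.ofReal (2 * Real.pi ^ 2 * (r - 0)))) :=
    ENNReal.tendsto_ofReal ((hlim.const_sub r).const_mul _)
  rw [sub_zero] at h2
  refine le_of_tendsto_of_tendsto' h2 h1 fun n => ?_
  have hn := hlt n
  have hp := hpos n
  have h3 := volume_ne_zero_of_mem_essBoundary (a := r - ε n) (b := r + ε n) hr
    ⟨by linarith, by linarith⟩
  exact le_measure_annulus hμ hE (by have := min_le_left r (lam - r); linarith)
    (by have := min_le_right r (lam - r); linarith) h3.1 h3.2

/-- The circles are disjoint, each carries mass at least `2π² a`, and all lie in a closed disk of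
finite measure. -/
theorem finite_essBoundary_inter_Icc (hμ : IsVariationMeasure (disk lam) φ μ)
    (hE : IsProfile lam E φ) {a b : ℝ} (ha : 0 < a) (hb : b < lam) :
    (essBoundary E ∩ Icc a b).Finite := by
  have h := Measure.finite_const_le_meas_of_disjoint_iUnion μ
    (ε := ENNReal.ofReal (2 * Real.pi ^ 2 * a))
    (As := fun r : Icc a b => Metric.sphere (0 : Plane) r)
    (by rw [ENNReal.ofReal_pos]; positivity) (fun r => Metric.isClosed_sphere.measurableSet) ?_ ?_
  · refine (h.image Subtype.val).subset ?_
    rintro r ⟨hr, hra, hrb⟩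
    refine ⟨⟨r, hra, hrb⟩, ?_, rfl⟩
    refine le_trans ?_ (le_measure_sphere hμ hE hr (ha.trans_le hra) (hrb.trans_lt hb))
    exact ENNReal.ofReal_le_ofReal (by gcongr)
  · intro r s hrs
    rw [Function.onFun, disjoint_left]
    intro x hx hx'
    rw [mem_sphere_zero_iff_norm] at hx hx'
    exact hrs (Subtype.ext (hx.symm.trans hx'))
  · refine ((measure_mono ?_).trans_lt (hμ.finite_on_compacts (Metric.closedBall 0 b)
      (isCompact_closedBall 0 b) (Metric.closedBall_subset_ball hb))).ne
    refine iUnion_subset fun r x hx => ?_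
    rw [mem_sphere_zero_iff_norm] at hx
    rw [mem_closedBall_zero_iff, hx]
    exact r.2.2

theorem volume_essBoundary_inter_Ioo (hμ : IsVariationMeasure (disk lam) φ μ)
    (hE : IsProfile lam E φ) : volume (essBoundary E ∩ Ioo 0 lam) = 0 := by
  have hsub : essBoundary E ∩ Ioo 0 lam ⊆
      ⋃ n : ℕ, essBoundary E ∩ Icc (1 / ((n : ℝ) + 1)) (lam - 1 / ((n : ℝ) + 1)) := by
    rintro r ⟨hr, h0, hl⟩
    obtain ⟨n, hn⟩ := exists_nat_one_div_lt (lt_min h0 (sub_pos.2 hl))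
    have h1 := hn.trans_le (min_le_left _ _)
    have h2 := hn.trans_le (min_le_right _ _)
    exact mem_iUnion.2 ⟨n, hr, h1.le, by linarith⟩
  refine measure_mono_null hsub (measure_iUnion_null fun n => ?_)
  refine (finite_essBoundary_inter_Icc hμ hE ?_ ?_).measure_zero _
  · positivity
  · have : 0 < 1 / ((n : ℝ) + 1) := by positivity
    linarith

/-- With a null essential boundary, almost every radius lies in one of the two essential interiors,
so `E` may be replaced by an open set. -/
theorem mem_iff_mem_essInterior_ae (hμ : IsVariationMeasure (disk lam) φ μ)
    (hE : IsProfile lam E φ) : ∀ᵐ r : ℝ, r ∈ Ioo 0 lam → (r ∈ E ↔ r ∈ essInterior E) := by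
  have h1 : ∀ᵐ r : ℝ, r ∉ essBoundary E ∩ Ioo 0 lam :=
    measure_eq_zero_iff_ae_notMem.1 (volume_essBoundary_inter_Ioo hμ hE)
  have h2 : ∀ᵐ r : ℝ, r ∉ essInterior E \ E :=
    measure_eq_zero_iff_ae_notMem.1 (volume_essInterior_diff E)
  have h3 : ∀ᵐ r : ℝ, r ∉ essInterior Eᶜ \ Eᶜ :=
    measure_eq_zero_iff_ae_notMem.1 (volume_essInterior_diff Eᶜ)
  filter_upwards [h1, h2, h3] with r hr1 hr2 hr3 hrI
  have h4 : r ∈ essInterior E ∪ essInterior Eᶜ := by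
    by_contra hc
    exact hr1 ⟨hc, hrI⟩
  constructor
  · intro hrE
    exact h4.resolve_right fun h => hr3 ⟨h, fun h' => h' hrE⟩
  · intro hrE
    by_contra hc
    exact hr2 ⟨hrE, hc⟩

end Profile

/-! ### Decomposition into intervals, hence into annuli. -/

/-- A point of an open bounded set lies in a maximal open interval of the set. -/
theorem exists_maximal_Ioo {A : Set ℝ} (hA : IsOpen A) {l u : ℝ} (hl : A ⊆ Ioo l u) {x : ℝ}
    (hx : x ∈ A) : ∃ a b, x ∈ Ioo a b ∧ Ioo a b ⊆ A ∧ a ∉ A ∧ b ∉ A ∧ l ≤ a ∧ b ≤ u := by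
  have hc : IsClosed Aᶜ := hA.isClosed_compl
  have n1 : (Aᶜ ∩ Iic x).Nonempty := ⟨l, fun h => (hl h).1.false, (hl hx).1.le⟩
  have n2 : (Aᶜ ∩ Ici x).Nonempty := ⟨u, fun h => (hl h).2.false, (hl hx).2.le⟩
  have b1 : BddAbove (Aᶜ ∩ Iic x) := ⟨x, fun _ h => h.2⟩
  have b2 : BddBelow (Aᶜ ∩ Ici x) := ⟨x, fun _ h => h.2⟩
  have m1 := (hc.inter isClosed_Iic).csSup_mem n1 b1
  have m2 := (hc.inter isClosed_Ici).csInf_mem n2 b2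
  refine ⟨sSup (Aᶜ ∩ Iic x), sInf (Aᶜ ∩ Ici x), ⟨?_, ?_⟩, ?_, m1.1, m2.1, ?_, ?_⟩
  · exact lt_of_le_of_ne m1.2 fun h => m1.1 (by rw [h]; exact hx)
  · exact lt_of_le_of_ne m2.2 fun h => m2.1 (by rw [← h]; exact hx)
  · intro y hy
    by_contra hyA
    rcases le_total y x with h | h
    · exact hy.1.not_ge (le_csSup b1 ⟨hyA, h⟩)
    · exact hy.2.not_ge (csInf_le b2 ⟨hyA, h⟩)
  · exact le_csSup b1 ⟨fun h => (hl h).1.false, (hl hx).1.le⟩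
  · exact csInf_le b2 ⟨fun h => (hl h).2.false, (hl hx).2.le⟩

/-- A bounded open set of reals is a countable disjoint union of open intervals. -/
theorem exists_iUnion_Ioo_eq {A : Set ℝ} (hA : IsOpen A) {l u : ℝ} (hlu : l ≤ u)
    (hl : A ⊆ Ioo l u) :
    ∃ a b : ℕ → ℝ, (∀ n, l ≤ a n ∧ a n ≤ b n ∧ b n ≤ u) ∧
      (Pairwise fun i j => Disjoint (Ioo (a i) (b i)) (Ioo (a j) (b j))) ∧
      ⋃ n, Ioo (a n) (b n) = A := by
  classical
  choose! a b hx hsub haA hbA hla hbu using fun x (hx : x ∈ A) => exists_maximal_Ioo hA hl hx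
  have heq : ∀ x ∈ A, ∀ y ∈ A, ∀ z, z ∈ Ioo (a x) (b x) → z ∈ Ioo (a y) (b y) →
      a x = a y ∧ b x = b y := by
    have hle : ∀ x ∈ A, ∀ y ∈ A, ∀ z, z ∈ Ioo (a x) (b x) → z ∈ Ioo (a y) (b y) →
        a x ≤ a y ∧ b y ≤ b x := by
      intro x hxA y hyA z hzx hzy
      constructor
      · by_contra! h
        exact haA x hxA (hsub y hyA ⟨h, hzx.1.trans hzy.2⟩)
      · by_contra! h
        exact hbA x hxA (hsub y hyA ⟨hzy.1.trans hzx.2, h⟩)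
    intro x hxA y hyA z hzx hzy
    have h1 := hle x hxA y hyA z hzx hzy
    have h2 := hle y hyA x hxA z hzy hzx
    exact ⟨le_antisymm h1.1 h2.1, le_antisymm h2.2 h1.2⟩
  obtain ⟨q, hq⟩ := exists_surjective_nat ℚ
  -- An index is kept when `q n` is the first enumerated rational of its component, components being
  -- told apart by their left endpoints. The other indices get the empty interval `Ioo l l`.
  let good : ℕ → Prop := fun n =>
    (q n : ℝ) ∈ A ∧ ∀ m < n, (q m : ℝ) ∈ A → a (q m) ≠ a (q n)
  refine ⟨fun n => if good n then a (q n) else l, fun n => if good n then b (q n) else l,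
    fun n => ?_, ?_, ?_⟩
  · by_cases hg : good n
    · simp only [if_pos hg]
      exact ⟨hla _ hg.1, ((hx _ hg.1).1.trans (hx _ hg.1).2).le, hbu _ hg.1⟩
    · simp only [if_neg hg]
      exact ⟨le_rfl, le_rfl, hlu⟩
  · have hne : ∀ i j, i < j → Disjoint
        (Ioo (if good i then a (q i) else l) (if good i then b (q i) else l))
        (Ioo (if good j then a (q j) else l) (if good j then b (q j) else l)) := by
      intro i j hij
      by_cases hi : good i
      · by_cases hj : good j
        · simp only [if_pos hi, if_pos hj]
          rw [disjoint_left]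
          intro z hzi hzj
          exact hj.2 i hij hi.1 (heq _ hi.1 _ hj.1 z hzi hzj).1
        · simp [if_neg hj]
      · simp [if_neg hi]
    intro i j hij
    rcases lt_or_gt_of_ne hij with h | h
    · exact hne i j h
    · exact (hne j i h).symm
  · ext y
    rw [mem_iUnion]
    constructor
    · rintro ⟨n, hn⟩
      by_cases hg : good n
      · simp only [if_pos hg] at hn
        exact hsub _ hg.1 hn
      · simp [if_neg hg] at hn
    · intro hy
      have hex : ∃ n, (q n : ℝ) ∈ A ∧ a (q n) = a y ∧ b (q n) = b y := by
        obtain ⟨p, hp1, hp2⟩ := exists_rat_btwn ((hx y hy).1.trans (hx y hy).2)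
        obtain ⟨n, rfl⟩ := hq p
        have hpA : (q n : ℝ) ∈ A := hsub y hy ⟨hp1, hp2⟩
        exact ⟨n, hpA, heq _ hpA _ hy _ (hx _ hpA) ⟨hp1, hp2⟩⟩
      obtain ⟨h1, h2, h3⟩ := Nat.find_spec hex
      have hg : good (Nat.find hex) := by
        refine ⟨h1, fun m hm hmA hmeq => Nat.find_min hex hm ⟨hmA, hmeq.trans h2, ?_⟩⟩
        have h4 := hx _ hmA
        have h5 := hx _ h1
        -- Two components with the same left endpoint overlap, hence coincide.
        have h6 : ∃ z, z ∈ Ioo (a (q m)) (b (q m)) ∧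
            z ∈ Ioo (a (q (Nat.find hex))) (b (q (Nat.find hex))) := by
          rw [hmeq] at h4 ⊢
          have h7 := lt_min (h4.1.trans h4.2) (h5.1.trans h5.2)
          obtain ⟨z, hz1, hz2⟩ := exists_between h7
          exact ⟨z, ⟨hz1, hz2.trans_le (min_le_left _ _)⟩, hz1, hz2.trans_le (min_le_right _ _)⟩
        obtain ⟨z, hz1, hz2⟩ := h6
        exact ((heq _ hmA _ h1 z hz1 hz2).2).trans h3
      refine ⟨Nat.find hex, ?_⟩
      simp only [if_pos hg, h2, h3]
      exact hx y hy

theorem isUnionOfAnnuli_of_isProfile {lam : ℝ} (hlam : 0 < lam) {E : Set ℝ} {φ : Plane → ℝ}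
    {μ : Measure Plane} (hμ : IsVariationMeasure (disk lam) φ μ) (hE : IsProfile lam E φ) :
    IsUnionOfAnnuli lam φ := by
  obtain ⟨a, b, hab, hd, hu⟩ := exists_iUnion_Ioo_eq
    ((isOpen_essInterior E).inter isOpen_Ioo) hlam.le (inter_subset_right (s := essInterior E))
  refine ⟨a, b, hab, fun i j hij => ?_, ?_⟩
  · exact (hd hij).preimage (fun x : Plane => ‖x‖)
  · have h := ae_norm_of_ae ((mem_iff_mem_essInterior_ae hμ hE).mono fun r hr _ => hr)
    filter_upwards [h, hE.2, (by simp [ae_iff] : ∀ᵐ x : Plane, x ≠ 0)] with x hx hx2 hx0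
    have h1 : (x ∈ ⋃ j, annulus (a j) (b j)) ↔ ‖x‖ ∈ essInterior E ∩ Ioo 0 lam := by
      rw [← hu, mem_iUnion, mem_iUnion]
      rfl
    have hpos : 0 < ‖x‖ := norm_pos_iff.2 hx0
    refine propext (Iff.trans ?_ h1.symm)
    change x ∈ disk lam ∧ φ x = 0 ↔ _
    constructor
    · rintro ⟨hxd, h0⟩
      have hI : ‖x‖ ∈ Ioo 0 lam := ⟨hpos, mem_disk.1 hxd⟩
      refine ⟨(hx hI).1 ?_, hI⟩
      by_contra hc
      rw [hx2 hxd, indicator_of_mem hc] at h0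
      exact Real.pi_ne_zero h0
    · rintro ⟨hi, hI⟩
      have hxd := mem_disk.2 hI.2
      refine ⟨hxd, ?_⟩
      rw [hx2 hxd, indicator_of_notMem]
      exact fun hc => hc ((hx hI).2 hi)

/-! ### The function `f` and the mass fraction. -/

section Profile

theorem f_nonneg {α : ℝ} (h0 : 0 ≤ α) (h1 : α ≤ 1) : 0 ≤ f α := by
  unfold f
  have h2 : √(1 - α) ≤ 1 := Real.sqrt_le_one.2 (by linarith)
  exact mul_nonneg (Real.rpow_nonneg (by linarith) _) (Real.rpow_nonneg (by linarith) _)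

theorem f_sq {α : ℝ} (h0 : 0 ≤ α) (h1 : α ≤ 1) : f α ^ 2 = √(1 - α) ^ 3 * (1 - √(1 - α)) := by
  have h2 : √(1 - α) ≤ 1 := Real.sqrt_le_one.2 (by linarith)
  have h3 : (0 : ℝ) ≤ 1 - α := by linarith
  unfold f
  rw [mul_pow, ← Real.rpow_natCast (_ ^ _ : ℝ) 2, ← Real.rpow_natCast ((1 - √(1 - α)) ^ _ : ℝ) 2,
    ← Real.rpow_mul h3, ← Real.rpow_mul (by linarith), Real.sqrt_eq_rpow,
    ← Real.rpow_natCast _ 3, ← Real.rpow_mul h3]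
  norm_num

/-- The substitution `s = √(1 - α)` makes the square of `f` a polynomial; all later estimates of `f`
go through it. -/
theorem f_one_sub_sq {s : ℝ} (h0 : 0 ≤ s) (h1 : s ≤ 1) : f (1 - s ^ 2) ^ 2 = s ^ 3 * (1 - s) := by
  rw [f_sq (by nlinarith) (by nlinarith), sub_sub_cancel, Real.sqrt_sq h0]

theorem f_gt_of_mem_Icc {α : ℝ} (hα : α ∈ Icc (0.1486 : ℝ) (1 - 0.1486)) : 3 / 16 < f α := by
  obtain ⟨h0, h1⟩ := hα
  obtain ⟨s, hs0, rfl⟩ : ∃ s : ℝ, 0 ≤ s ∧ α = 1 - s ^ 2 := ⟨√(1 - α), Real.sqrt_nonneg _, by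
    rw [Real.sq_sqrt (by linarith)]; ring⟩
  have hs1 : (0.38548 : ℝ) ≤ s := by
    by_contra! hc
    nlinarith
  have hs2 : s ≤ 0.92272 := by
    by_contra! hc
    nlinarith
  refine lt_of_pow_lt_pow_left₀ 2 (f_nonneg (by nlinarith) (by nlinarith)) ?_
  rw [f_one_sub_sq hs0 (by linarith)]
  -- The polynomial `s³(1 - s)` peaks at `s = 3/4`. To the left, the difference from its value at
  -- `0.38548` is factored; to the right, crude bounds on two pieces exceed `(3/16)²`.
  rcases le_total s 0.75 with h | h
  · have h3 : (0.38548 : ℝ) ^ 3 * (1 - 0.38548) ≤ s ^ 3 * (1 - s) := by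
      have h4 : 3 * (0.38548 : ℝ) ^ 2 * 0.25 ≤
          (s ^ 2 + s * 0.38548 + 0.38548 ^ 2) * (1 - s) :=
        mul_le_mul (by nlinarith) (by linarith) (by norm_num) (by positivity)
      have h5 : 0 ≤ (s - 0.38548) *
          ((s ^ 2 + s * 0.38548 + 0.38548 ^ 2) * (1 - s) - 0.38548 ^ 3) :=
        mul_nonneg (sub_nonneg.2 hs1) (sub_nonneg.2 (le_trans (by norm_num) h4))
      linear_combination h5
    refine lt_of_lt_of_le ?_ h3
    norm_num
  · rcases le_total s 0.85 with h7 | h7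
    · have h8 : (0.75 : ℝ) ^ 3 * (1 - 0.85) ≤ s ^ 3 * (1 - s) :=
        mul_le_mul (pow_le_pow_left₀ (by norm_num) h 3) (by linarith) (by norm_num) (by positivity)
      refine lt_of_lt_of_le ?_ h8
      norm_num
    · have h8 : (0.85 : ℝ) ^ 3 * (1 - 0.92272) ≤ s ^ 3 * (1 - s) :=
        mul_le_mul (pow_le_pow_left₀ (by norm_num) h7 3) (by linarith) (by norm_num) (by positivity)
      refine lt_of_lt_of_le ?_ h8
      norm_num

/-- `f(α) / α` is nonincreasing. -/
theorem mul_f_le_mul_f {u δ : ℝ} (hu : 0 ≤ u) (huδ : u ≤ δ) (hδ : δ ≤ 1) :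
    u * f δ ≤ δ * f u := by
  obtain ⟨s, hs0, rfl⟩ : ∃ s : ℝ, 0 ≤ s ∧ u = 1 - s ^ 2 := ⟨√(1 - u), Real.sqrt_nonneg _, by
    rw [Real.sq_sqrt (by linarith)]; ring⟩
  obtain ⟨t, ht0, rfl⟩ : ∃ t : ℝ, 0 ≤ t ∧ δ = 1 - t ^ 2 := ⟨√(1 - δ), Real.sqrt_nonneg _, by
    rw [Real.sq_sqrt (by linarith)]; ring⟩
  have hs1 : s ≤ 1 := by nlinarith
  have hts : t ≤ s := by nlinarith
  refine le_of_pow_le_pow_left₀ two_ne_zero (mul_nonneg (by linarith) (f_nonneg hu (by linarith))) ?_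
  rw [mul_pow, mul_pow, f_one_sub_sq hs0 hs1, f_one_sub_sq ht0 (hts.trans hs1)]
  -- After squaring and removing the common factor `(1 - s)(1 - t)`, the claim is the product of
  -- `h1` and `h2`.
  have h1 : (t * (1 + s)) ^ 2 ≤ (s * (1 + t)) ^ 2 := by
    refine pow_le_pow_left₀ (by positivity) (by nlinarith) 2
  have h2 : t * (1 - s) ≤ s * (1 - t) := by nlinarith
  have h3 : (t * (1 + s)) ^ 2 * (t * (1 - s)) ≤ (s * (1 + t)) ^ 2 * (s * (1 - t)) :=
    mul_le_mul h1 h2 (mul_nonneg ht0 (by linarith)) (by positivity)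
  have h4 : 0 ≤ (1 - s) * (1 - t) := mul_nonneg (by linarith) (by linarith)
  nlinarith [mul_le_mul_of_nonneg_left h3 h4]

/-- `f(1 - α) / α` is nonincreasing. -/
theorem mul_f_one_sub_le_mul_f_one_sub {u δ : ℝ} (hu : 0 ≤ u) (huδ : u ≤ δ) (hδ : δ ≤ 1) :
    u * f (1 - δ) ≤ δ * f (1 - u) := by
  obtain ⟨s, hs0, rfl⟩ : ∃ s : ℝ, 0 ≤ s ∧ u = s ^ 2 := ⟨√u, Real.sqrt_nonneg _, by
    rw [Real.sq_sqrt hu]⟩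
  obtain ⟨t, ht0, rfl⟩ : ∃ t : ℝ, 0 ≤ t ∧ δ = t ^ 2 := ⟨√δ, Real.sqrt_nonneg _, by
    rw [Real.sq_sqrt (by linarith)]⟩
  have hst : s ≤ t := by nlinarith
  have ht1 : t ≤ 1 := by nlinarith
  refine le_of_pow_le_pow_left₀ two_ne_zero (mul_nonneg (by positivity) (f_nonneg (by nlinarith) (by nlinarith))) ?_
  rw [mul_pow, mul_pow, f_one_sub_sq hs0 (hst.trans ht1), f_one_sub_sq ht0 ht1]
  -- This is the squared claim without the common factor `(s t)³`.
  have h2 : s * (1 - t) ≤ t * (1 - s) := by nlinarith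
  have h4 : 0 ≤ (s * t) ^ 3 := by positivity
  nlinarith [mul_le_mul_of_nonneg_left h2 h4]

/-- The part of the mass in the disk of radius `r`. -/
def massFraction (lam r : ℝ) : ℝ := 1 - (1 - (r / lam) ^ 2) ^ 2

/-- Here `√(1 - m) = 1 - (r / lam)²` for `m = massFraction lam r`. This identifies `f` as the
rescaled cost of the circle enclosing a given mass. -/
theorem f_massFraction {lam r : ℝ} (hlam : 0 < lam) (h0 : 0 ≤ r) (hr : r ≤ lam) :
    f (massFraction lam r) = (lam ^ 2 - r ^ 2) ^ (3 / 2 : ℝ) * r / lam ^ 4 := by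
  have hx0 : 0 ≤ r / lam := by positivity
  have hx1 : r / lam ≤ 1 := (div_le_one hlam).2 hr
  have hy0 : 0 ≤ 1 - (r / lam) ^ 2 := by nlinarith
  have hy1 : 1 - (r / lam) ^ 2 ≤ 1 := by nlinarith
  have hd : 0 ≤ lam ^ 2 - r ^ 2 := by nlinarith
  refine (sq_eq_sq₀ (f_nonneg ?_ ?_) ?_).1 ?_
  · unfold massFraction; nlinarith
  · unfold massFraction; nlinarith
  · positivity
  have h3 : ((lam ^ 2 - r ^ 2) ^ (3 / 2 : ℝ)) ^ 2 = (lam ^ 2 - r ^ 2) ^ 3 := by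
    rw [← Real.rpow_natCast _ 2, ← Real.rpow_mul hd]
    norm_num
  rw [massFraction, f_one_sub_sq hy0 hy1, div_pow (_ * _), mul_pow, h3]
  field_simp
  ring

theorem pi_mul_pow_four {lam : ℝ} (hlam : 0 < lam) (h : ∫ x in disk lam, rho lam x = 1) :
    Real.pi * lam ^ 4 = 2 := by
  have h1 := setIntegral_disk_norm_eq (lam := lam) fun r => max (lam ^ 2 - r ^ 2) 0
  have h2 : ∫ r in Ioo 0 lam, r * max (lam ^ 2 - r ^ 2) 0 = lam ^ 4 / 4 := by
    have h3 : ∫ r in Ioo 0 lam, r * max (lam ^ 2 - r ^ 2) 0 =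
        ∫ r in Ioo 0 lam, (lam ^ 2 * r - r ^ 3) := by
      refine setIntegral_congr_fun measurableSet_Ioo fun r hr => ?_
      have : 0 ≤ lam ^ 2 - r ^ 2 := by nlinarith [hr.1, hr.2]
      simp only [max_eq_left this]
      ring
    rw [h3, ← integral_Ioc_eq_integral_Ioo, ← intervalIntegral.integral_of_le hlam.le,
      intervalIntegral.integral_sub (Continuous.intervalIntegrable (by fun_prop) _ _)
      (Continuous.intervalIntegrable (by fun_prop) _ _),
      intervalIntegral.integral_const_mul, integral_id, integral_pow]
    norm_num
    ring
  change ∫ x in disk lam, rho lam x = _ at h1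
  rw [h, h2] at h1
  linarith

theorem setIntegral_Ioo_weight {lam : ℝ} (hlam : Real.pi * lam ^ 4 = 2) {c d : ℝ} (hcd : c ≤ d) :
    ∫ r in Ioo c d, 2 * Real.pi * (r * (lam ^ 2 - r ^ 2)) =
      massFraction lam d - massFraction lam c := by
  have h0 : lam ≠ 0 := by rintro rfl; norm_num at hlam
  rw [← integral_Ioc_eq_integral_Ioo, ← intervalIntegral.integral_of_le hcd]
  refine intervalIntegral.integral_eq_sub_of_hasDerivAt (fun r _ => ?_)
    (Continuous.intervalIntegrable (by fun_prop) _ _)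
  have h1 : HasDerivAt (fun r => 1 - (1 - (r / lam) ^ 2) ^ 2)
      (-(2 * (1 - (r / lam) ^ 2) ^ 1 * (-(2 * (r / lam) ^ 1 * (1 / lam))))) r := by
    have h2 := ((hasDerivAt_id r).div_const lam).pow 2
    have h3 := ((h2.const_sub 1).pow 2).const_sub 1
    simpa using h3
  have h4 : Real.pi = 2 / lam ^ 4 := by field_simp; linarith
  refine h1.congr_deriv ?_
  rw [h4]
  field_simp

variable {lam : ℝ} {E : Set ℝ} {φ : Plane → ℝ} {μ : Measure Plane}

theorem integrableOn_weight (lam : ℝ) :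
    IntegrableOn (fun r => 2 * Real.pi * (r * (lam ^ 2 - r ^ 2))) (Ioo 0 lam) := by
  refine IntegrableOn.mono_set ?_ Ioo_subset_Icc_self
  exact Continuous.integrableOn_Icc (by fun_prop)

/-! ### Boundary circles forced by the mass constraint. -/

/-- The mass constraint in terms of the profile. -/
theorem setIntegral_profile (hlam : 0 < lam) (hl4 : Real.pi * lam ^ 4 = 2) (hE : IsProfile lam E φ)
    {α : ℝ} (hα : ∫ x, rho lam x * Real.cos (φ x) = α - (1 - α)) :
    ∫ r in Ioo 0 lam ∩ Eᶜ, 2 * Real.pi * (r * (lam ^ 2 - r ^ 2)) = 1 - α ∧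
      ∫ r in Ioo 0 lam ∩ E, 2 * Real.pi * (r * (lam ^ 2 - r ^ 2)) = α := by
  set w : ℝ → ℝ := fun r => 2 * Real.pi * (r * (lam ^ 2 - r ^ 2)) with hw
  have htot : ∫ r in Ioo 0 lam, w r = 1 := by
    rw [hw, setIntegral_Ioo_weight hl4 hlam.le]
    simp [massFraction, hlam.ne']
  have hi := integrableOn_weight lam
  have hadd := setIntegral_union (μ := volume) (f := w) (s := Ioo 0 lam ∩ E) (t := Ioo 0 lam ∩ Eᶜ)
    ((disjoint_compl_right : Disjoint E Eᶜ).mono inter_subset_right inter_subset_right)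
    (measurableSet_Ioo.inter hE.1.compl) (hi.mono_set inter_subset_left)
    (hi.mono_set inter_subset_left)
  rw [inter_union_compl, htot] at hadd
  have h1 : ∫ x, rho lam x * Real.cos (φ x) =
      ∫ x in disk lam, (fun r => (lam ^ 2 - r ^ 2) * (E.indicator 1 r - Eᶜ.indicator 1 r)) ‖x‖ := by
    rw [← setIntegral_eq_integral_of_forall_compl_eq_zero (s := disk lam)]
    · refine setIntegral_congr_ae (measurableSet_disk lam) ?_
      filter_upwards [hE.2] with x hx hxd
      have hn := mem_disk.1 hxd
      have : 0 ≤ lam ^ 2 - ‖x‖ ^ 2 := by nlinarith [norm_nonneg x]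
      rw [hx hxd, rho, max_eq_left this]
      by_cases h : ‖x‖ ∈ E <;> simp [h]
    · intro x hx
      rw [mem_disk, not_lt] at hx
      have : lam ^ 2 - ‖x‖ ^ 2 ≤ 0 := by nlinarith
      rw [rho, max_eq_right this, zero_mul]
  rw [hα, setIntegral_disk_norm_eq fun r => (lam ^ 2 - r ^ 2) * (E.indicator 1 r - Eᶜ.indicator 1 r),
    ← integral_const_mul] at h1
  have h2 : ∫ r in Ioo 0 lam, 2 * Real.pi * (r * ((lam ^ 2 - r ^ 2) *
      (E.indicator 1 r - Eᶜ.indicator 1 r))) =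
      (∫ r in Ioo 0 lam, E.indicator w r) - ∫ r in Ioo 0 lam, Eᶜ.indicator w r := by
    rw [← integral_sub (hi.indicator hE.1) (hi.indicator hE.1.compl)]
    congr 1
    funext r
    by_cases h : r ∈ E
    · simp [h]
    · simp [h]
      ring
  rw [h2, setIntegral_indicator hE.1, setIntegral_indicator hE.1.compl] at h1
  constructor <;> linarith

/-- Up to a null set `Eᶜ` misses `(a, b)`, so only the mass below `a` and beyond `b` is available to
it. -/
theorem le_massFraction_of_Ioo_subset (hl4 : Real.pi * lam ^ 4 = 2) (hlam : 0 < lam) {a b : ℝ} (ha : 0 ≤ a) (hab : a < b) (hb : b ≤ lam)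
    (hsub : Ioo a b ⊆ essInterior E) :
    ∫ r in Ioo 0 lam ∩ Eᶜ, 2 * Real.pi * (r * (lam ^ 2 - r ^ 2)) ≤
      massFraction lam a + (1 - massFraction lam b) := by
  set w : ℝ → ℝ := fun r => 2 * Real.pi * (r * (lam ^ 2 - r ^ 2)) with hw
  have htot : ∫ r in Ioo 0 lam, w r = 1 := by
    rw [hw, setIntegral_Ioo_weight hl4 hlam.le]
    simp [massFraction, hlam.ne']
  have hi := integrableOn_weight lam
  have hIsub : Ioo a b ⊆ Ioo 0 lam := Ioo_subset_Ioo ha hb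
  have hdis : AEDisjoint volume (Ioo 0 lam ∩ Eᶜ) (Ioo a b) := by
    refine measure_mono_null ?_ (volume_essInterior_diff E)
    rintro r ⟨⟨-, hr⟩, hr'⟩
    exact ⟨hsub hr', hr⟩
  have h1 := setIntegral_union₀ (f := w) hdis measurableSet_Ioo.nullMeasurableSet
    (hi.mono_set inter_subset_left) (hi.mono_set hIsub)
  have h2 : ∫ r in Ioo 0 lam ∩ Eᶜ ∪ Ioo a b, w r ≤ ∫ r in Ioo 0 lam, w r := by
    refine setIntegral_mono_set hi ?_ (union_subset inter_subset_left hIsub).eventuallyLE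
    rw [Filter.EventuallyLE, ae_restrict_iff' measurableSet_Ioo]
    refine Filter.Eventually.of_forall fun r hr => ?_
    have h3 : 0 ≤ lam ^ 2 - r ^ 2 := by nlinarith [hr.1, hr.2]
    have h4 : 0 < r := hr.1
    have := Real.pi_pos
    simp only [Pi.zero_apply, hw]
    positivity
  have h5 : ∫ r in Ioo a b, w r = _ := setIntegral_Ioo_weight hl4 hab.le
  rw [h1, h5, htot] at h2
  linarith

theorem massFraction_lt {r s : ℝ} (hlam : 0 < lam) (hr : 0 ≤ r) (hrs : r < s) (hs : s ≤ lam) :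
    massFraction lam r < massFraction lam s := by
  have h1 : r / lam < s / lam := by gcongr
  have h2 : 0 ≤ r / lam := by positivity
  have h3 : s / lam ≤ 1 := (div_le_one hlam).2 hs
  have h4 : (r / lam) ^ 2 < (s / lam) ^ 2 := by gcongr
  have h5 : (s / lam) ^ 2 ≤ 1 := by nlinarith
  unfold massFraction
  nlinarith

/-- The component of `E` around the half-mass radius leaves too little room on either side alone for
the mass `δ` of `Eᶜ`, so it has two boundary circles. Monotonicity of `f(u)/u` and `f(1 - u)/u`
compares their costs with those at `δ` and `1 - δ`. -/
theorem exists_two_essBoundary (hlam : 0 < lam) (hl4 : Real.pi * lam ^ 4 = 2)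
    {δ : ℝ} (hδ0 : 0 < δ)
    (hf : ∀ α ∈ Icc δ (1 - δ), 3 / 16 < f α) (hδ : δ ≤ 1 / 2)
    (hmass : δ ≤ ∫ r in Ioo 0 lam ∩ Eᶜ, 2 * Real.pi * (r * (lam ^ 2 - r ^ 2)))
    (hno : ∀ r ∈ essBoundary E, r ∈ Ioo 0 lam → massFraction lam r ∉ Icc δ (1 - δ))
    {r₀ : ℝ} (hr₀ : r₀ ∈ essInterior E) (hrI : r₀ ∈ Ioo 0 lam)
    (hm₀ : massFraction lam r₀ = 1 / 2) :
    ∃ a b, a < b ∧ (a ∈ essBoundary E ∧ a ∈ Ioo 0 lam) ∧ (b ∈ essBoundary E ∧ b ∈ Ioo 0 lam) ∧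
      3 / 16 < f (massFraction lam a) + f (massFraction lam b) := by
  obtain ⟨a, b, hab, hsub, haA, hbA, ha, hb⟩ := exists_maximal_Ioo
    ((isOpen_essInterior E).inter isOpen_Ioo) (inter_subset_right (s := essInterior E)) ⟨hr₀, hrI⟩
  have hlt : a < b := hab.1.trans hab.2
  have hsub' : Ioo a b ⊆ essInterior E := hsub.trans inter_subset_left
  have hm := hmass.trans (le_massFraction_of_Ioo_subset hl4 hlam ha hlt hb hsub')
  have m0 : massFraction lam 0 = 0 := by simp [massFraction]
  have m1 : massFraction lam lam = 1 := by simp [massFraction, hlam.ne']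
  -- An endpoint inside `(0, lam)` is outside `essInterior E` by maximality, and outside
  -- `essInterior Eᶜ` because that set is open and disjoint from `Ioo a b`; hence it is a boundary
  -- radius.
  have hcl : ∀ c ∈ closure (Ioo a b), c ∉ essInterior Eᶜ := by
    intro c hc hc'
    obtain ⟨z, hz1, hz2⟩ := mem_closure_iff.1 hc _ (isOpen_essInterior Eᶜ) hc'
    exact disjoint_left.1 (disjoint_essInterior E) (hsub' hz2) hz1
  rw [closure_Ioo hlt.ne] at hcl
  have hma : massFraction lam a < 1 / 2 := hm₀ ▸ massFraction_lt hlam ha hab.1 hrI.2.le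
  have hmb : 1 / 2 < massFraction lam b := hm₀ ▸ massFraction_lt hlam hrI.1.le hab.2 hb
  have haJ : a ∈ Ioo 0 lam → a ∈ essBoundary E ∧ massFraction lam a < δ := by
    intro haI
    have hJ : a ∈ essBoundary E := by
      rintro (h | h)
      · exact haA ⟨h, haI⟩
      · exact hcl a (left_mem_Icc.2 hlt.le) h
    refine ⟨hJ, ?_⟩
    by_contra! hc
    exact hno a hJ haI ⟨hc, by linarith⟩
  have hbJ : b ∈ Ioo 0 lam → b ∈ essBoundary E ∧ 1 - δ < massFraction lam b := by
    intro hbI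
    have hJ : b ∈ essBoundary E := by
      rintro (h | h)
      · exact hbA ⟨h, hbI⟩
      · exact hcl b (right_mem_Icc.2 hlt.le) h
    refine ⟨hJ, ?_⟩
    by_contra! hc
    exact hno b hJ hbI ⟨by linarith, hc⟩
  have hblt : b < lam := by
    refine lt_of_le_of_ne hb fun h => ?_
    rw [h, m1, sub_self, add_zero] at hm
    rcases eq_or_lt_of_le ha with h' | h'
    · rw [← h', m0] at hm; linarith
    · exact ((haJ ⟨h', hab.1.trans hrI.2⟩).2).not_ge hm
  have hbI : b ∈ Ioo 0 lam := ⟨hrI.1.trans hab.2, hblt⟩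
  obtain ⟨hbJ1, hbJ2⟩ := hbJ hbI
  have hapos : 0 < a := by
    refine lt_of_le_of_ne ha fun h => ?_
    rw [← h, m0] at hm
    linarith
  have haI : a ∈ Ioo 0 lam := ⟨hapos, hab.1.trans hrI.2⟩
  obtain ⟨haJ1, haJ2⟩ := haJ haI
  refine ⟨a, b, hlt, ⟨haJ1, haI⟩, ⟨hbJ1, hbI⟩, ?_⟩
  have ma0 : 0 ≤ massFraction lam a := m0 ▸ (massFraction_lt hlam le_rfl hapos haI.2.le).le
  have mb1 : massFraction lam b ≤ 1 := m1 ▸ (massFraction_lt hlam hbI.1.le hblt le_rfl).le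
  have e1 := mul_f_le_mul_f ma0 haJ2.le (by linarith)
  have e2 := mul_f_one_sub_le_mul_f_one_sub (u := 1 - massFraction lam b) (δ := δ) (by linarith)
    (by linarith) (by linarith)
  rw [sub_sub_cancel] at e2
  have f1 := hf δ ⟨le_rfl, by linarith⟩
  have f2 := hf (1 - δ) ⟨by linarith, le_rfl⟩
  have hpos : 0 < massFraction lam a + (1 - massFraction lam b) := by linarith
  have e3 : 3 / 16 * (massFraction lam a + (1 - massFraction lam b)) <
      massFraction lam a * f δ + (1 - massFraction lam b) * f (1 - δ) := by
    have hma' : 0 < massFraction lam a := m0 ▸ massFraction_lt hlam le_rfl hapos haI.2.le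
    nlinarith [mul_lt_mul_of_pos_left f1 hma',
      mul_le_mul_of_nonneg_left f2.le (sub_nonneg.2 mb1)]
  have e4 : δ * (3 / 16) < δ * (f (massFraction lam a) + f (massFraction lam b)) := by
    nlinarith
  exact lt_of_mul_lt_mul_left e4 hδ0.le

theorem exists_finset_essBoundary (hlam : 0 < lam) (hl4 : Real.pi * lam ^ 4 = 2)
    (hE : IsProfile lam E φ) {δ α : ℝ} (hδ0 : 0 < δ)
    (hf : ∀ α ∈ Icc δ (1 - δ), 3 / 16 < f α) (hα : α ∈ Icc δ (1 - δ))
    (hm : ∫ x, rho lam x * Real.cos (φ x) = α - (1 - α)) :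
    ∃ S : Finset ℝ, (∀ r ∈ S, r ∈ essBoundary E ∧ r ∈ Ioo 0 lam) ∧
      3 / 16 < ∑ r ∈ S, f (massFraction lam r) := by
  have hδ : δ ≤ 1 / 2 := by linarith [hα.1, hα.2]
  by_cases hex : ∃ r ∈ essBoundary E, r ∈ Ioo 0 lam ∧ massFraction lam r ∈ Icc δ (1 - δ)
  · obtain ⟨r, hr, hrI, hrm⟩ := hex
    refine ⟨{r}, by simpa using ⟨hr, hrI⟩, ?_⟩
    rw [Finset.sum_singleton]
    exact hf _ hrm
  push Not at hex
  obtain ⟨r₀, hrI, hr₀⟩ : ∃ r ∈ Ioo 0 lam, massFraction lam r = 1 / 2 := by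
    have hc : ContinuousOn (massFraction lam) (Icc 0 lam) := by
      unfold massFraction
      fun_prop
    have := intermediate_value_Ioo hlam.le hc
    have h := this (show (1 / 2 : ℝ) ∈ Ioo (massFraction lam 0) (massFraction lam lam) by
      simp [massFraction, hlam.ne']; norm_num)
    obtain ⟨r, hr1, hr2⟩ := h
    exact ⟨r, hr1, hr2⟩
  have hmm := setIntegral_profile hlam hl4 hE hm
  have hfin : ∀ a b, a < b → (a ∈ essBoundary E ∧ a ∈ Ioo 0 lam) →
      (b ∈ essBoundary E ∧ b ∈ Ioo 0 lam) →
      3 / 16 < f (massFraction lam a) + f (massFraction lam b) →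
      ∃ S : Finset ℝ, (∀ r ∈ S, r ∈ essBoundary E ∧ r ∈ Ioo 0 lam) ∧
        3 / 16 < ∑ r ∈ S, f (massFraction lam r) := by
    intro a b hab ha hb h
    refine ⟨{a, b}, ?_, ?_⟩
    · intro r hr
      rw [Finset.mem_insert, Finset.mem_singleton] at hr
      rcases hr with rfl | rfl
      exacts [ha, hb]
    · rwa [Finset.sum_pair hab.ne]
  have hor : r₀ ∈ essInterior E ∪ essInterior Eᶜ := by
    by_contra hc
    exact hex r₀ hc hrI ⟨by linarith, by linarith⟩
  rcases hor with h | h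
  · obtain ⟨a, b, hab, ha, hb, hab'⟩ := exists_two_essBoundary hlam hl4 hδ0 hf hδ
      (by rw [hmm.1]; linarith [hα.2]) hex h hrI hr₀
    exact hfin a b hab ha hb hab'
  -- The two phases play symmetric roles: `E` and `Eᶜ` have the same essential boundary, and both
  -- have mass at least `δ`.
  · rw [← essBoundary_compl] at hex hfin
    obtain ⟨a, b, hab, ha, hb, hab'⟩ := exists_two_essBoundary hlam hl4 hδ0 hf hδ
      (by rw [compl_compl, hmm.2]; exact hα.1) hex h hrI hr₀
    rw [← essBoundary_compl]
    exact hfin a b hab ha hb hab'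

/-! ### Lower bound for the radial energy. -/

theorem sigma_pos : 0 < sigma := by
  have : ∫ t in (0 : ℝ)..1, (1 - t ^ 2) = 2 / 3 := by
    rw [intervalIntegral.integral_sub (Continuous.intervalIntegrable (by fun_prop) _ _)
      (Continuous.intervalIntegrable (by fun_prop) _ _), integral_pow]
    norm_num
  rw [sigma, this]
  positivity

/-- The weight is constant on each circle, and `(2σ/π) (λ² - r²)^(3/2) · 2π² r = 8σ f(m(r))` once `π
= 2/λ⁴`. Discarding the rest of `|Dφ|` is harmless for a lower bound. -/
theorem le_energy_of_profile (hlam : 0 < lam) (hl4 : Real.pi * lam ^ 4 = 2)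
    (hμ : IsVariationMeasure (disk lam) φ μ) (hE : IsProfile lam E φ) {S : Finset ℝ}
    (hS : ∀ r ∈ S, r ∈ essBoundary E ∧ r ∈ Ioo 0 lam) :
    ENNReal.ofReal (8 * sigma * ∑ r ∈ S, f (massFraction lam r)) ≤ energy lam φ := by
  rw [energy, variationMeasure_eq (isOpen_disk lam) hμ]
  have hsub : (⋃ r ∈ S, Metric.sphere (0 : Plane) r) ⊆ disk lam := by
    refine iUnion₂_subset fun r hr x hx => ?_
    rw [mem_disk, mem_sphere_zero_iff_norm.1 hx]
    exact (hS r hr).2.2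
  have hle : ∑ r ∈ S, ENNReal.ofReal ((lam ^ 2 - r ^ 2) ^ (3 / 2 : ℝ)) *
      ENNReal.ofReal (2 * Real.pi ^ 2 * r) ≤
      ∫⁻ x in disk lam, ENNReal.ofReal (rho lam x ^ (3 / 2 : ℝ)) ∂μ := by
    refine le_trans ?_ (lintegral_mono_set hsub)
    rw [lintegral_biUnion_finset]
    · refine Finset.sum_le_sum fun r hr => ?_
      have hc : ∫⁻ x in Metric.sphere (0 : Plane) r, ENNReal.ofReal (rho lam x ^ (3 / 2 : ℝ)) ∂μ =
          ∫⁻ _ in Metric.sphere (0 : Plane) r,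
            ENNReal.ofReal ((lam ^ 2 - r ^ 2) ^ (3 / 2 : ℝ)) ∂μ := by
        refine setLIntegral_congr_fun Metric.isClosed_sphere.measurableSet fun x hx => ?_
        have hrI := (hS r hr).2
        have h0 : 0 ≤ lam ^ 2 - r ^ 2 := by nlinarith [hrI.1, hrI.2]
        simp only [rho, mem_sphere_zero_iff_norm.1 hx, max_eq_left h0]
      rw [hc, setLIntegral_const]
      gcongr
      exact le_measure_sphere hμ hE (hS r hr).1 (hS r hr).2.1 (hS r hr).2.2
    · intro r _ s _ hrs
      rw [Function.onFun, disjoint_left]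
      intro x hx hx'
      rw [mem_sphere_zero_iff_norm] at hx hx'
      exact hrs (hx.symm.trans hx')
    · exact fun r _ => Metric.isClosed_sphere.measurableSet
  refine le_trans (le_of_eq ?_) (mul_le_mul_right hle _)
  have hs := sigma_pos
  have hpi := Real.pi_pos
  have hnn : ∀ r ∈ S, 0 ≤ (lam ^ 2 - r ^ 2) ^ (3 / 2 : ℝ) := fun r hr => by
    have hrI := (hS r hr).2
    exact Real.rpow_nonneg (by nlinarith [hrI.1, hrI.2]) _
  have e : ∑ r ∈ S, ENNReal.ofReal ((lam ^ 2 - r ^ 2) ^ (3 / 2 : ℝ)) *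
      ENNReal.ofReal (2 * Real.pi ^ 2 * r) =
      ENNReal.ofReal (∑ r ∈ S, (lam ^ 2 - r ^ 2) ^ (3 / 2 : ℝ) * (2 * Real.pi ^ 2 * r)) := by
    rw [ENNReal.ofReal_sum_of_nonneg]
    · exact Finset.sum_congr rfl fun r hr => (ENNReal.ofReal_mul (hnn r hr)).symm
    · intro r hr
      have := (hS r hr).2.1
      exact mul_nonneg (hnn r hr) (by positivity)
  rw [e, ← ENNReal.ofReal_mul (by positivity), Finset.mul_sum, Finset.mul_sum]
  congr 1
  refine Finset.sum_congr rfl fun r hr => ?_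
  rw [f_massFraction hlam (hS r hr).2.1.le (hS r hr).2.2.le]
  have h4 : Real.pi = 2 / lam ^ 4 := by field_simp; linarith
  have h5 : 2 * sigma / Real.pi * ((lam ^ 2 - r ^ 2) ^ (3 / 2 : ℝ) * (2 * Real.pi ^ 2 * r)) =
      4 * sigma * Real.pi * ((lam ^ 2 - r ^ 2) ^ (3 / 2 : ℝ) * r) := by
    field_simp
    ring
  rw [h5, h4]
  ring

end Profile

/-! ### Gauss–Green on a sector. -/

/-- The radial unit vector in the direction `θ`. -/
def radialVec (θ : ℝ) : Plane := !₂[Real.cos θ, Real.sin θ]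

/-- The angular unit vector in the direction `θ`. -/
def angularVec (θ : ℝ) : Plane := !₂[-Real.sin θ, Real.cos θ]

theorem norm_angularVec (θ : ℝ) : ‖angularVec θ‖ = 1 := by
  rw [EuclideanSpace.norm_eq, Real.sqrt_eq_one]
  simp [angularVec, Fin.sum_univ_two]

theorem inner_angularVec (x : Plane) (θ : ℝ) :
    inner ℝ x (angularVec θ) = x 0 * -Real.sin θ + x 1 * Real.cos θ := by
  simp [angularVec, PiLp.inner_apply, Fin.sum_univ_two, mul_comm]

theorem inner_radialVec (x : Plane) (θ : ℝ) :
    inner ℝ x (radialVec θ) = x 0 * Real.cos θ + x 1 * Real.sin θ := by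
  simp [radialVec, PiLp.inner_apply, Fin.sum_univ_two, mul_comm]

theorem polarMap_eq_smul_single (p : ℝ × ℝ) :
    polarMap p = (p.1 * Real.cos p.2) • EuclideanSpace.single 0 1 +
      (p.1 * Real.sin p.2) • EuclideanSpace.single 1 1 := by
  ext i
  fin_cases i <;> simp [polarMap]

theorem contDiff_polarMap : ContDiff ℝ ∞ polarMap := by
  have : polarMap = fun p : ℝ × ℝ => (p.1 * Real.cos p.2) • (EuclideanSpace.single 0 1 : Plane) +
      (p.1 * Real.sin p.2) • EuclideanSpace.single 1 1 := funext polarMap_eq_smul_single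
  rw [this]
  fun_prop

theorem hasDerivAt_polarMap_fst (r θ : ℝ) :
    HasDerivAt (fun t => polarMap (t, θ)) (Real.cos θ • EuclideanSpace.single 0 1 +
      Real.sin θ • EuclideanSpace.single 1 1) r := by
  simp only [polarMap_eq_smul_single]
  have h := (((hasDerivAt_id r).mul_const (Real.cos θ)).smul_const
    (EuclideanSpace.single 0 1 : Plane)).add
    (((hasDerivAt_id r).mul_const (Real.sin θ)).smul_const (EuclideanSpace.single 1 1 : Plane))
  simpa using! h

theorem hasDerivAt_polarMap_snd (r θ : ℝ) :
    HasDerivAt (fun t => polarMap (r, t)) ((r * -Real.sin θ) • EuclideanSpace.single 0 1 +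
      (r * Real.cos θ) • EuclideanSpace.single 1 1) θ := by
  simp only [polarMap_eq_smul_single]
  exact (((Real.hasDerivAt_cos θ).const_mul r).smul_const
    (EuclideanSpace.single 0 1 : Plane)).add
    (((Real.hasDerivAt_sin θ).const_mul r).smul_const (EuclideanSpace.single 1 1 : Plane))

section GaussGreen

variable {ψ : Plane → Plane}

theorem contDiff_comp_polarMap (hψ : ContDiff ℝ ∞ ψ) (i : Fin 2) :
    ContDiff ℝ ∞ (fun p => ψ (polarMap p) i) :=
  (contDiff_euclidean.1 (hψ.comp contDiff_polarMap)) i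

/-- The divergence in polar coordinates. -/
theorem mul_divergence_polarMap (hψ : ContDiff ℝ ∞ ψ) (p : ℝ × ℝ) :
    fderiv ℝ (fun p : ℝ × ℝ => p.1 * inner ℝ (ψ (polarMap p)) (radialVec p.2)) p (1, 0) +
      fderiv ℝ (fun p : ℝ × ℝ => inner ℝ (ψ (polarMap p)) (angularVec p.2)) p (0, 1) =
    p.1 * divergence ψ (polarMap p) := by
  obtain ⟨r, θ⟩ := p
  simp only [inner_radialVec, inner_angularVec]
  have hc := contDiff_comp_polarMap hψ
  have h0 := hc 0
  have h1 := hc 1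
  set D := fderiv ℝ ψ (polarMap (r, θ)) with hD
  have hDψ : HasFDerivAt ψ D (polarMap (r, θ)) :=
    (hψ.differentiable (by simp) _).hasFDerivAt
  have hr : HasDerivAt (fun t => ψ (polarMap (t, θ))) (D (Real.cos θ • EuclideanSpace.single 0 1 +
      Real.sin θ • EuclideanSpace.single 1 1)) r :=
    hDψ.comp_hasDerivAt r (hasDerivAt_polarMap_fst r θ)
  have ht : HasDerivAt (fun t => ψ (polarMap (r, t)))
      (D ((r * -Real.sin θ) • EuclideanSpace.single 0 1 +
      (r * Real.cos θ) • EuclideanSpace.single 1 1)) θ :=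
    hDψ.comp_hasDerivAt θ (hasDerivAt_polarMap_snd r θ)
  have hri : ∀ i : Fin 2, HasDerivAt (fun t => ψ (polarMap (t, θ)) i) (D (Real.cos θ •
      EuclideanSpace.single 0 1 + Real.sin θ • EuclideanSpace.single 1 1) i) r := fun i =>
    (EuclideanSpace.proj i : Plane →L[ℝ] ℝ).hasFDerivAt.comp_hasDerivAt r hr
  have hti : ∀ i : Fin 2, HasDerivAt (fun t => ψ (polarMap (r, t)) i)
      (D ((r * -Real.sin θ) • EuclideanSpace.single 0 1 +
      (r * Real.cos θ) • EuclideanSpace.single 1 1) i) θ := fun i =>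
    (EuclideanSpace.proj i : Plane →L[ℝ] ℝ).hasFDerivAt.comp_hasDerivAt θ ht
  have e1 := ((hasDerivAt_id r).mul (((hri 0).mul_const (Real.cos θ)).add
    ((hri 1).mul_const (Real.sin θ))))
  have e2 := ((hti 0).mul (Real.hasDerivAt_sin θ).neg).add ((hti 1).mul (Real.hasDerivAt_cos θ))
  have d1 : DifferentiableAt ℝ (fun p : ℝ × ℝ => p.1 * (ψ (polarMap p) 0 * Real.cos p.2 +
      ψ (polarMap p) 1 * Real.sin p.2)) (r, θ) := by
    refine ContDiff.differentiable (n := ∞) ?_ (by simp) _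
    exact contDiff_fst.mul ((h0.mul (by fun_prop)).add (h1.mul (by fun_prop)))
  have d2 : DifferentiableAt ℝ (fun p : ℝ × ℝ => ψ (polarMap p) 0 * -Real.sin p.2 +
      ψ (polarMap p) 1 * Real.cos p.2) (r, θ) := by
    refine ContDiff.differentiable (n := ∞) ?_ (by simp) _
    exact (h0.mul (by fun_prop)).add (h1.mul (by fun_prop))
  have c1 := d1.hasFDerivAt.comp_hasDerivAt r ((hasDerivAt_id r).prodMk (hasDerivAt_const r θ))
  have c2 := d2.hasFDerivAt.comp_hasDerivAt θ ((hasDerivAt_const θ r).prodMk (hasDerivAt_id θ))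
  rw [c1.unique e1, c2.unique e2, divergence, Fin.sum_univ_two, ← hD]
  simp only [map_add, map_smul, PiLp.add_apply, PiLp.smul_apply, smul_eq_mul, id, Pi.add_apply,
    Pi.neg_apply]
  -- The undifferentiated terms `± ψ · e_r` cancel; what is left is the trace of `D` in the rotated
  -- frame.
  linear_combination (r * D (EuclideanSpace.single 0 1) 0 + r * D (EuclideanSpace.single 1 1) 1) *
    Real.sin_sq_add_cos_sq θ

/-- This is the divergence theorem on the rectangle of polar coordinates. The side `r = 0` drops out
through the factor `r`, the side `r = lam` because `ψ` vanishes there, and the two rays remain. -/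
theorem setIntegral_sector_divergence {lam : ℝ} (hlam : 0 < lam)
    (hψ : IsTestField (disk lam) ψ) {θ β : ℝ} (hβ0 : 0 ≤ β) (hβ : β ≤ 2 * Real.pi) :
    ∫ x in sector lam θ β, divergence ψ x =
      (∫ r in Ioo 0 lam, inner ℝ (ψ (polarMap (r, θ + β))) (angularVec (θ + β))) -
        ∫ r in Ioo 0 lam, inner ℝ (ψ (polarMap (r, θ))) (angularVec θ) := by
  have hc := contDiff_comp_polarMap hψ.contDiff
  have h0 := hc 0
  have h1 := hc 1
  have d1 : ContDiff ℝ ∞ (fun p : ℝ × ℝ => p.1 * inner ℝ (ψ (polarMap p)) (radialVec p.2)) := by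
    simp only [inner_radialVec]
    exact contDiff_fst.mul ((h0.mul (by fun_prop)).add (h1.mul (by fun_prop)))
  have d2 : ContDiff ℝ ∞ (fun p : ℝ × ℝ => inner ℝ (ψ (polarMap p)) (angularVec p.2)) := by
    simp only [inner_angularVec]
    exact (h0.mul (by fun_prop)).add (h1.mul (by fun_prop))
  have hcont : Continuous fun p : ℝ × ℝ => p.1 * divergence ψ (polarMap p) := by
    simp only [← mul_divergence_polarMap hψ.contDiff]
    exact ((d1.continuous_fderiv (by simp)).clm_apply continuous_const).add
      ((d2.continuous_fderiv (by simp)).clm_apply continuous_const)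
  have hgg := integral2_divergence_prod_of_hasFDerivAt
    (fun p : ℝ × ℝ => p.1 * inner ℝ (ψ (polarMap p)) (radialVec p.2))
    (fun p : ℝ × ℝ => inner ℝ (ψ (polarMap p)) (angularVec p.2)) _ _ 0 θ lam (θ + β)
    d1.continuous.continuousOn d2.continuous.continuousOn
    (fun p _ => (d1.differentiable (by simp) p).hasFDerivAt)
    (fun p _ => (d2.differentiable (by simp) p).hasFDerivAt)
    (by
      simp only [mul_divergence_polarMap hψ.contDiff]
      exact hcont.continuousOn.integrableOn_compact (isCompact_uIcc.prod isCompact_uIcc))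
  simp only [mul_divergence_polarMap hψ.contDiff] at hgg
  have hz : ∀ y, ψ (polarMap (lam, y)) = 0 := fun y => by
    refine image_eq_zero_of_notMem_tsupport fun hm => ?_
    have := mem_disk.1 (hψ.tsupport_subset hm)
    rw [norm_polarMap, abs_of_pos hlam] at this
    exact this.false
  simp only [hz, inner_zero_left, mul_zero, zero_mul, intervalIntegral.integral_zero, add_zero,
    sub_zero] at hgg
  rw [setIntegral_sector hβ, Measure.volume_eq_prod, setIntegral_prod]
  · simp only [← integral_Ioc_eq_integral_Ioo]
    rw [← intervalIntegral.integral_of_le hlam.le, ← intervalIntegral.integral_of_le hlam.le,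
      ← intervalIntegral.integral_of_le hlam.le, ← hgg]
    refine intervalIntegral.integral_congr fun r _ => ?_
    exact (intervalIntegral.integral_of_le (by linarith)).symm
  · have : IntegrableOn (fun p : ℝ × ℝ => p.1 * divergence ψ (polarMap p))
        (Icc 0 lam ×ˢ Icc θ (θ + β)) (volume.prod volume) :=
      hcont.continuousOn.integrableOn_compact (isCompact_Icc.prod isCompact_Icc)
    exact this.mono_set (prod_mono Ioo_subset_Icc_self Ioo_subset_Icc_self)

end GaussGreen

/-- The line through the origin in the direction `θ` is a null set. -/
theorem ae_inner_angularVec_ne_zero (θ : ℝ) : ∀ᵐ x : Plane, inner ℝ x (angularVec θ) ≠ 0 := by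
  have h : volume (LinearMap.ker (innerSL ℝ (angularVec θ)).toLinearMap : Set Plane) = 0 := by
    refine Measure.addHaar_submodule _ _ fun h => ?_
    have h1 : angularVec θ ∈ LinearMap.ker (innerSL ℝ (angularVec θ)).toLinearMap := by
      rw [h]; trivial
    rw [LinearMap.mem_ker] at h1
    have h2 : inner ℝ (angularVec θ) (angularVec θ) = (0 : ℝ) := h1
    rw [real_inner_self_eq_norm_sq, norm_angularVec] at h2
    norm_num at h2
  rw [ae_iff]
  refine measure_mono_null (fun x hx => ?_) h
  have h2 : inner ℝ x (angularVec θ) = 0 := by simpa using hx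
  rw [real_inner_comm] at h2
  exact h2

theorem inner_polarMap_angularVec (r θ τ : ℝ) :
    inner ℝ (polarMap (r, θ)) (angularVec τ) = r * Real.sin (θ - τ) := by
  rw [inner_angularVec, Real.sin_sub]
  simp [polarMap]
  ring

theorem inner_polarMap_radialVec (r θ τ : ℝ) :
    inner ℝ (polarMap (r, θ)) (radialVec τ) = r * Real.cos (θ - τ) := by
  rw [inner_radialVec, Real.cos_sub]
  simp [polarMap]
  ring

/-- The complement of a sector in the disk is a sector, up to a null set. -/
theorem mem_sector_compl_ae {lam θ β : ℝ} (hβ0 : 0 ≤ β) (hβ : β ≤ 2 * Real.pi) :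
    ∀ᵐ x : Plane, x ∈ disk lam →
      (x ∈ sector lam (θ + β) (2 * Real.pi - β) ↔ x ∉ sector lam θ β) := by
  filter_upwards [ae_inner_angularVec_ne_zero θ, ae_inner_angularVec_ne_zero (θ + β)]
    with x h1 h2 hxd
  obtain ⟨τ, hτ, hx⟩ := exists_polarMap_eq θ x
  have h0 : 0 < ‖x‖ := by
    rw [norm_pos_iff]
    rintro rfl
    simp at h1
  have hn : τ ≠ θ := by
    rintro rfl
    rw [← hx, inner_polarMap_angularVec] at h1
    simp at h1
  have hn' : τ ≠ θ + β := by
    rintro rfl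
    rw [← hx, inner_polarMap_angularVec] at h2
    simp at h2
  have hl := mem_disk.1 hxd
  constructor
  · rintro hs2 hs1
    rw [sector_eq_image] at hs1 hs2
    obtain ⟨p, ⟨hp1, hp2⟩, hpx⟩ := hs1
    obtain ⟨q, ⟨hq1, hq2⟩, hqx⟩ := hs2
    have hpq : p = q := by
      refine injOn_polarMap (θ₀ := θ) le_rfl (Ioo 0 lam) (fun r hr => hr.1) ⟨hp1, ?_⟩ ⟨hq1, ?_⟩
        (hpx.trans hqx.symm)
      · exact ⟨hp2.1, by linarith [hp2.2]⟩
      · exact ⟨by linarith [hq2.1], by linarith [hq2.2]⟩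
    rw [hpq] at hp2
    exact hp2.2.not_gt hq2.1
  · intro hs
    rw [sector_eq_image] at hs ⊢
    refine ⟨(‖x‖, τ), ⟨⟨h0, hl⟩, ?_, by linarith [hτ.2]⟩, hx⟩
    by_contra! hc
    exact hs ⟨(‖x‖, τ), ⟨⟨h0, hl⟩, lt_of_le_of_ne hτ.1 hn.symm, lt_of_le_of_ne hc hn'⟩, hx⟩

theorem sector_subset_disk (lam θ β : ℝ) : sector lam θ β ⊆ disk lam := by
  rw [sector_eq_image]
  rintro _ ⟨⟨r, τ⟩, ⟨hr, -⟩, rfl⟩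
  rw [mem_disk, norm_polarMap, abs_of_pos hr.1]
  exact hr.2

/-! ### The variation measure of a sector. -/

/-- Arc length on the ray of direction `θ` in the disk. -/
def rayMeasure (lam θ : ℝ) : Measure Plane :=
  (volume.restrict (Ioo 0 lam)).map fun r => polarMap (r, θ)

theorem continuous_polarMap_ray (θ : ℝ) : Continuous fun r => polarMap (r, θ) :=
  continuous_polarMap.comp (by fun_prop)

instance (lam θ : ℝ) : IsFiniteMeasure (rayMeasure lam θ) := by
  unfold rayMeasure
  infer_instance

theorem ae_rayMeasure {lam θ : ℝ} {P : Plane → Prop} (hP : MeasurableSet {x | P x})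
    (h : ∀ r ∈ Ioo 0 lam, P (polarMap (r, θ))) : ∀ᵐ x ∂(rayMeasure lam θ), P x := by
  rw [rayMeasure, ae_map_iff (continuous_polarMap_ray θ).measurable.aemeasurable hP,
    ae_restrict_iff' measurableSet_Ioo]
  exact Filter.Eventually.of_forall h

theorem integral_rayMeasure {lam θ : ℝ} {F : Plane → ℝ} (hF : Measurable F) :
    ∫ x, F x ∂(rayMeasure lam θ) = ∫ r in Ioo 0 lam, F (polarMap (r, θ)) :=
  integral_map (continuous_polarMap_ray θ).measurable.aemeasurable hF.aestronglyMeasurable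

/-- The total variation measure of a function jumping by `π` across the two sides of a sector. -/
def sectorMeasure (lam θ β : ℝ) : Measure Plane :=
  ENNReal.ofReal Real.pi • (rayMeasure lam θ + rayMeasure lam (θ + β))

instance (lam θ β : ℝ) : IsFiniteMeasure (sectorMeasure lam θ β) :=
  Measure.smul_finite _ ENNReal.ofReal_ne_top

theorem ae_sectorMeasure_mem_disk (lam θ β : ℝ) :
    ∀ᵐ x ∂(sectorMeasure lam θ β), x ∈ disk lam := by
  have h : ∀ τ, ∀ᵐ x ∂(rayMeasure lam τ), x ∈ disk lam := fun τ =>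
    ae_rayMeasure (measurableSet_disk lam) fun r hr => by
      rw [mem_disk, norm_polarMap, abs_of_pos hr.1]
      exact hr.2
  exact Measure.ae_smul_measure (ae_add_measure_iff.2 ⟨h _, h _⟩) _

open Classical in
/-- The polar direction of the gradient on the two sides of a sector. -/
def sectorNormal (θ β : ℝ) (x : Plane) : Plane :=
  if inner ℝ x (angularVec θ) = 0 ∧ 0 < inner ℝ x (radialVec θ) then -angularVec θ
  else angularVec (θ + β)

theorem measurable_sectorNormal (θ β : ℝ) : Measurable (sectorNormal θ β) := by
  refine Measurable.ite ?_ measurable_const measurable_const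
  have h1 : Measurable fun x : Plane => inner ℝ x (angularVec θ) := by fun_prop
  have h2 : Measurable fun x : Plane => inner ℝ x (radialVec θ) := by fun_prop
  exact (h1 (measurableSet_singleton 0)).inter (h2 measurableSet_Ioi)

theorem norm_sectorNormal (θ β : ℝ) (x : Plane) : ‖sectorNormal θ β x‖ = 1 := by
  unfold sectorNormal
  split_ifs
  · rw [norm_neg, norm_angularVec]
  · exact norm_angularVec _

theorem sectorNormal_left {θ β r : ℝ} (hr : 0 < r) :
    sectorNormal θ β (polarMap (r, θ)) = -angularVec θ := by
  rw [sectorNormal, if_pos]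
  rw [inner_polarMap_angularVec, inner_polarMap_radialVec]
  simpa using hr

/-- The two sides are distinct rays: otherwise `sin β = 0` and `cos β > 0`, impossible for `0 < β <
2π`. -/
theorem sectorNormal_right {θ β r : ℝ} (hr : 0 < r) (hβ0 : 0 < β) (hβ : β < 2 * Real.pi) :
    sectorNormal θ β (polarMap (r, θ + β)) = angularVec (θ + β) := by
  rw [sectorNormal, if_neg]
  rw [inner_polarMap_angularVec, inner_polarMap_radialVec, add_sub_cancel_left]
  rintro ⟨h1, h2⟩
  have hs : Real.sin β = 0 := (mul_eq_zero.1 h1).resolve_left hr.ne'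
  have hc : 0 < Real.cos β := pos_of_mul_pos_right h2 hr.le
  have hc1 : Real.cos β = 1 := by
    have := Real.sin_sq_add_cos_sq β
    rw [hs] at this
    nlinarith
  have := (Real.cos_eq_one_iff_of_lt_of_lt (by linarith) hβ).1 hc1
  exact hβ0.ne' this

section Sector

variable {lam θ β : ℝ} {φ : Plane → ℝ}

theorem eq_indicator_of_sector
    (hv : ∀ᵐ x ∂(volume.restrict (disk lam)), φ x = 0 ∨ φ x = Real.pi)
    (hs : {x | x ∈ disk lam ∧ φ x = 0} =ᵐ[volume] sector lam θ β) :
    ∀ᵐ x : Plane, x ∈ disk lam → φ x = (sector lam θ β)ᶜ.indicator (fun _ => Real.pi) x := by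
  rw [ae_restrict_iff' (measurableSet_disk lam)] at hv
  filter_upwards [hv, hs] with x hx hxs hxd
  have h1 : (x ∈ disk lam ∧ φ x = 0) ↔ x ∈ sector lam θ β := iff_of_eq hxs
  by_cases hm : x ∈ sector lam θ β
  · rw [(h1.2 hm).2, indicator_of_notMem (by simpa using hm)]
  · rw [indicator_of_mem hm]
    exact (hx hxd).resolve_left fun h => hm (h1.1 ⟨hxd, h⟩)

/-- Up to a null set `φ` is `π` on the complementary sector and `0` elsewhere, so Gauss–Green on
that sector gives the ray integrals, with signs absorbed by `sectorNormal`. -/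
theorem isVariationMeasure_sector (hlam : 0 < lam) (hβ0 : 0 < β) (hβ : β < 2 * Real.pi)
    (hφ : ∀ᵐ x : Plane, x ∈ disk lam →
      φ x = (sector lam θ β)ᶜ.indicator (fun _ => Real.pi) x) :
    IsVariationMeasure (disk lam) φ (sectorMeasure lam θ β) := by
  refine ⟨ae_iff.1 (ae_sectorMeasure_mem_disk lam θ β), fun K _ _ => measure_lt_top _ _,
    sectorNormal θ β, measurable_sectorNormal θ β,
    Filter.Eventually.of_forall (norm_sectorNormal θ β), fun ψ hψ => ?_⟩
  have hsub : sector lam (θ + β) (2 * Real.pi - β) ⊆ disk lam := sector_subset_disk _ _ _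
  have h1 : ∫ x in disk lam, φ x * divergence ψ x =
      Real.pi * ∫ x in sector lam (θ + β) (2 * Real.pi - β), divergence ψ x := by
    rw [← integral_const_mul, ← inter_eq_self_of_subset_right hsub,
      ← setIntegral_indicator (measurableSet_sector (by linarith))]
    refine setIntegral_congr_ae (measurableSet_disk lam) ?_
    filter_upwards [hφ, mem_sector_compl_ae hβ0.le hβ.le] with x hx hx2 hxd
    rw [hx hxd]
    by_cases hm : x ∈ sector lam θ β
    · rw [indicator_of_notMem (by simpa using hm),
        indicator_of_notMem fun h => (hx2 hxd).1 h hm, zero_mul]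
    · rw [indicator_of_mem hm, indicator_of_mem ((hx2 hxd).2 hm)]
  rw [h1, setIntegral_sector_divergence hlam hψ (by linarith) (by linarith)]
  have hψm : Measurable fun x => inner ℝ (ψ x) (sectorNormal θ β x) :=
    hψ.contDiff.continuous.measurable.inner (measurable_sectorNormal θ β)
  obtain ⟨C, hC⟩ := hψ.contDiff.continuous.bounded_above_of_compact_support hψ.hasCompactSupport
  have hint : ∀ τ, Integrable (fun x => inner ℝ (ψ x) (sectorNormal θ β x)) (rayMeasure lam τ) :=
    fun τ => by
      refine Integrable.of_bound hψm.aestronglyMeasurable C (Filter.Eventually.of_forall fun x => ?_)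
      refine (norm_inner_le_norm _ _).trans ?_
      rw [norm_sectorNormal, mul_one]
      exact hC x
  rw [sectorMeasure, integral_smul_measure, integral_add_measure (hint _) (hint _),
    ENNReal.toReal_ofReal Real.pi_pos.le, integral_rayMeasure hψm, integral_rayMeasure hψm]
  have e1 : ∫ r in Ioo 0 lam, inner ℝ (ψ (polarMap (r, θ))) (sectorNormal θ β (polarMap (r, θ))) =
      -∫ r in Ioo 0 lam, inner ℝ (ψ (polarMap (r, θ))) (angularVec θ) := by
    rw [← integral_neg]
    refine setIntegral_congr_fun measurableSet_Ioo fun r hr => ?_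
    simp only [sectorNormal_left hr.1, inner_neg_right]
  have e2 : ∫ r in Ioo 0 lam, inner ℝ (ψ (polarMap (r, θ + β)))
      (sectorNormal θ β (polarMap (r, θ + β))) =
      ∫ r in Ioo 0 lam, inner ℝ (ψ (polarMap (r, θ + β))) (angularVec (θ + β)) := by
    refine setIntegral_congr_fun measurableSet_Ioo fun r hr => ?_
    simp only [sectorNormal_right hr.1 hβ0 hβ]
  -- The complementary sector ends at the angle `θ + 2π`, which is the ray `θ` again.
  have e3 : ∀ r, polarMap (r, θ + β + (2 * Real.pi - β)) = polarMap (r, θ) := fun r => by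
    have : θ + β + (2 * Real.pi - β) = θ + 2 * Real.pi := by ring
    rw [this]
    simp [polarMap]
  have e4 : angularVec (θ + β + (2 * Real.pi - β)) = angularVec θ := by
    have : θ + β + (2 * Real.pi - β) = θ + 2 * Real.pi := by ring
    rw [this]
    simp [angularVec]
  simp only [e1, e2, e3, e4, smul_eq_mul]
  ring

/-! ### Energy and mass of a sector. -/

theorem integral_rpow_three_halves {lam : ℝ} (hlam : 0 < lam) :
    ∫ r in (0 : ℝ)..lam, (lam ^ 2 - r ^ 2) ^ (3 / 2 : ℝ) = 3 * Real.pi / 16 * lam ^ 4 := by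
  -- The substitution `r = lam sin t` reduces the integral to that of `cos⁴`.
  have h := intervalIntegral.integral_comp_mul_deriv (a := 0) (b := Real.pi / 2)
    (f := fun t => lam * Real.sin t) (f' := fun t => lam * Real.cos t)
    (g := fun r => (lam ^ 2 - r ^ 2) ^ (3 / 2 : ℝ))
    (fun t _ => (Real.hasDerivAt_sin t).const_mul lam) (by fun_prop)
    (Continuous.rpow_const (by fun_prop) fun _ => Or.inr (by norm_num))
  simp only [Real.sin_zero, Real.sin_pi_div_two, mul_zero, mul_one] at h
  rw [← h]
  have h2 : ∀ t ∈ uIcc 0 (Real.pi / 2), ((fun r => (lam ^ 2 - r ^ 2) ^ (3 / 2 : ℝ)) ∘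
      fun t => lam * Real.sin t) t * (lam * Real.cos t) = lam ^ 4 * Real.cos t ^ 4 := by
    intro t ht
    rw [uIcc_of_le (by positivity)] at ht
    have hc : 0 ≤ Real.cos t := Real.cos_nonneg_of_mem_Icc ⟨by linarith [ht.1, Real.pi_pos], ht.2⟩
    have h3 : lam ^ 2 - (lam * Real.sin t) ^ 2 = (lam * Real.cos t) ^ 2 := by
      linear_combination -lam ^ 2 * Real.sin_sq_add_cos_sq t
    have h4 : ((lam * Real.cos t) ^ 2) ^ (3 / 2 : ℝ) = (lam * Real.cos t) ^ 3 := by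
      rw [← Real.rpow_natCast _ 2, ← Real.rpow_mul (by positivity), ← Real.rpow_natCast _ 3]
      norm_num
    simp only [Function.comp, h3, h4]
    ring
  rw [intervalIntegral.integral_congr h2, intervalIntegral.integral_const_mul,
    integral_cos_pow 2, integral_cos_sq]
  simp
  ring

theorem lintegral_rayMeasure_rho (hlam : 0 < lam) (θ : ℝ) :
    ∫⁻ x, ENNReal.ofReal (rho lam x ^ (3 / 2 : ℝ)) ∂(rayMeasure lam θ) =
      ENNReal.ofReal (3 * Real.pi / 16 * lam ^ 4) := by
  have hm : Measurable fun x : Plane => ENNReal.ofReal (rho lam x ^ (3 / 2 : ℝ)) := by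
    unfold rho
    fun_prop
  have hcont : Continuous fun r : ℝ => (lam ^ 2 - r ^ 2) ^ (3 / 2 : ℝ) :=
    Continuous.rpow_const (by fun_prop) fun _ => Or.inr (by norm_num)
  have hi : IntegrableOn (fun r : ℝ => (lam ^ 2 - r ^ 2) ^ (3 / 2 : ℝ)) (Ioo 0 lam) :=
    hcont.integrableOn_Icc.mono_set Ioo_subset_Icc_self
  rw [rayMeasure, lintegral_map hm (continuous_polarMap_ray θ).measurable,
    ← integral_rpow_three_halves hlam, intervalIntegral.integral_of_le hlam.le,
    integral_Ioc_eq_integral_Ioo, ofReal_integral_eq_lintegral_ofReal hi]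
  · refine setLIntegral_congr_fun measurableSet_Ioo fun r hr => ?_
    have h0 : 0 ≤ lam ^ 2 - r ^ 2 := by nlinarith [hr.1, hr.2]
    simp only [rho, norm_polarMap, sq_abs, max_eq_left h0]
  · rw [Filter.EventuallyLE, ae_restrict_iff' measurableSet_Ioo]
    refine Filter.Eventually.of_forall fun r hr => ?_
    exact Real.rpow_nonneg (by nlinarith [hr.1, hr.2]) _

theorem energy_sector (hlam : 0 < lam) (hl4 : Real.pi * lam ^ 4 = 2) (hβ0 : 0 < β)
    (hβ : β < 2 * Real.pi) (hφ : ∀ᵐ x : Plane, x ∈ disk lam →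
      φ x = (sector lam θ β)ᶜ.indicator (fun _ => Real.pi) x) :
    energy lam φ = ENNReal.ofReal (8 * sigma * (3 / 16)) := by
  have hs := sigma_pos
  have hpi := Real.pi_pos
  rw [energy, variationMeasure_eq (isOpen_disk lam) (isVariationMeasure_sector hlam hβ0 hβ hφ),
    Measure.restrict_eq_self_of_ae_mem (ae_sectorMeasure_mem_disk lam θ β), sectorMeasure,
    lintegral_smul_measure, lintegral_add_measure, lintegral_rayMeasure_rho hlam,
    lintegral_rayMeasure_rho hlam, smul_eq_mul, ← ENNReal.ofReal_add (by positivity) (by positivity),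
    ← ENNReal.ofReal_mul hpi.le, ← ENNReal.ofReal_mul (by positivity)]
  congr 1
  have h4 : lam ^ 4 = 2 / Real.pi := by field_simp; linarith
  rw [h4]
  field_simp
  ring

theorem setIntegral_sector_rho (hlam : 0 < lam) (hl4 : Real.pi * lam ^ 4 = 2) (hβ0 : 0 ≤ β)
    (hβ : β ≤ 2 * Real.pi) : ∫ x in sector lam θ β, rho lam x = β / (2 * Real.pi) := by
  have h1 : ∫ p in Ioo 0 lam ×ˢ Ioo θ (θ + β), p.1 * rho lam (polarMap p) =
      ∫ p in Ioo 0 lam ×ˢ Ioo θ (θ + β), (p.1 * (lam ^ 2 - p.1 ^ 2)) * 1 := by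
    refine setIntegral_congr_fun (measurableSet_Ioo.prod measurableSet_Ioo) fun p hp => ?_
    have h0 : 0 ≤ lam ^ 2 - p.1 ^ 2 := by nlinarith [hp.1.1, hp.1.2]
    simp only [rho, norm_polarMap, sq_abs, max_eq_left h0, mul_one]
  have h2 : ∫ r in Ioo 0 lam, r * (lam ^ 2 - r ^ 2) = 1 / (2 * Real.pi) := by
    have h3 := setIntegral_Ioo_weight hl4 hlam.le
    rw [integral_const_mul] at h3
    have h4 : massFraction lam lam - massFraction lam 0 = 1 := by
      simp [massFraction, hlam.ne']
    rw [h4] at h3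
    rw [eq_div_iff Real.two_pi_pos.ne']
    linarith
  rw [setIntegral_sector hβ, h1, Measure.volume_eq_prod,
    setIntegral_prod_mul (fun r => r * (lam ^ 2 - r ^ 2)) (fun _ => (1 : ℝ)), h2]
  simp [hβ0]
  ring

theorem integrable_rho (lam : ℝ) : Integrable (rho lam) := by
  refine Continuous.integrable_of_hasCompactSupport (by unfold rho; fun_prop)
    (HasCompactSupport.intro (isCompact_closedBall 0 |lam|) fun x hx => ?_)
  rw [mem_closedBall_zero_iff, not_le] at hx
  have : lam ^ 2 - ‖x‖ ^ 2 ≤ 0 := by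
    rw [← sq_abs lam]
    nlinarith [abs_nonneg lam]
  rw [rho, max_eq_right this]

theorem rho_eq_zero (hlam : 0 < lam) {x : Plane} (hx : x ∉ disk lam) : rho lam x = 0 := by
  rw [mem_disk, not_lt] at hx
  rw [rho, max_eq_right]
  nlinarith

theorem indicator_sector_mem_X (hlam : 0 < lam) (hρ : ∫ x in disk lam, rho lam x = 1) {α : ℝ}
    (h0 : 0 < α) (h1 : α < 1) (θ : ℝ) :
    (sector lam θ (2 * Real.pi * α))ᶜ.indicator (fun _ => Real.pi) ∈ X lam α := by
  have hpi := Real.pi_pos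
  have hβ : 2 * Real.pi * α < 2 * Real.pi := by nlinarith
  have hl4 := pi_mul_pow_four hlam hρ
  have hm := measurableSet_sector (lam := lam) (θ₀ := θ) hβ.le
  refine ⟨⟨?_, _, isVariationMeasure_sector hlam (by positivity) hβ
    (Filter.Eventually.of_forall fun _ _ => rfl)⟩, ?_, ?_⟩
  · have : LocallyIntegrable (fun _ : Plane => Real.pi) := locallyIntegrable_const _
    exact (this.indicator hm.compl).locallyIntegrableOn _
  · refine Filter.Eventually.of_forall fun x => ?_
    by_cases hx : x ∈ sector lam θ (2 * Real.pi * α) <;> simp [hx]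
  -- The cosine is `1` on the sector and `-1` off it. The opening `2πα` gives the sector mass `α`,
  -- so the integral is `2α - 1`.
  · have e : ∀ x, rho lam x * Real.cos
        ((sector lam θ (2 * Real.pi * α))ᶜ.indicator (fun _ => Real.pi) x) =
        2 * (sector lam θ (2 * Real.pi * α)).indicator (rho lam) x - rho lam x := by
      intro x
      by_cases hx : x ∈ sector lam θ (2 * Real.pi * α)
      · simp [hx]; ring
      · simp [hx]
    simp only [e]
    rw [integral_sub (((integrable_rho lam).indicator hm).const_mul 2) (integrable_rho lam),
      integral_const_mul, integral_indicator hm,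
      setIntegral_sector_rho hlam hl4 (by positivity) hβ.le,
      ← setIntegral_eq_integral_of_forall_compl_eq_zero (fun x hx => rho_eq_zero hlam hx), hρ]
    field_simp
    ring

end Sector

/-! ### Comparison of radial functions with sectors. -/

theorem lt_energy_of_isRadial {lam α δ : ℝ} (hlam : 0 < lam)
    (hρ : ∫ x in disk lam, rho lam x = 1) (hδ0 : 0 < δ)
    (hf : ∀ α ∈ Icc δ (1 - δ), 3 / 16 < f α) (hα : α ∈ Icc δ (1 - δ)) {φ : Plane → ℝ}
    (hφ : φ ∈ X lam α) (hr : IsRadial lam φ) :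
    ENNReal.ofReal (8 * sigma * (3 / 16)) < energy lam φ := by
  obtain ⟨⟨hloc, μ, hμ⟩, hv, hm⟩ := hφ
  have hl4 := pi_mul_pow_four hlam hρ
  obtain ⟨E, hE⟩ := exists_isProfile
    (hloc.aestronglyMeasurable) hv hr
  obtain ⟨S, hS, hlt⟩ := exists_finset_essBoundary hlam hl4 hE hδ0 hf hα hm
  refine lt_of_lt_of_le ?_ (le_energy_of_profile hlam hl4 hμ hE hS)
  have hs := sigma_pos
  rw [ENNReal.ofReal_lt_ofReal_iff_of_nonneg (by positivity)]
  gcongr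

end TwoBEC

end

theorem mainTheorem4 :
    (∀ α ∈ Set.Icc (0.1486 : ℝ) (1 - 0.1486), 3 / 16 < TwoBEC.f α) ∧
    ∀ lam : ℝ, 0 < lam → (∫ x in TwoBEC.disk lam, TwoBEC.rho lam x) = 1 →
    ∀ δ₀ : ℝ, (∀ α ∈ Set.Icc δ₀ (1 - δ₀), 3 / 16 < TwoBEC.f α) →
    ∀ α₁ ∈ Set.Icc δ₀ (1 - δ₀),
      (∀ φ : TwoBEC.Plane → ℝ, TwoBEC.IsMinimizer lam α₁ φ → ¬ TwoBEC.IsRadial lam φ) ∧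
      (∀ φ ∈ TwoBEC.X lam α₁, TwoBEC.IsRadial lam φ → TwoBEC.IsUnionOfAnnuli lam φ) ∧
      (∃ φds ∈ TwoBEC.X lam α₁, TwoBEC.IsDiskSector lam φds) ∧
      (∀ φds ∈ TwoBEC.X lam α₁, TwoBEC.IsDiskSector lam φds →
        TwoBEC.energy lam φds / ENNReal.ofReal (8 * TwoBEC.sigma) = 3 / 16 ∧
        ∀ φ ∈ TwoBEC.X lam α₁, TwoBEC.IsRadial lam φ →
          TwoBEC.energy lam φds < TwoBEC.energy lam φ) := by
  refine ⟨fun α hα => TwoBEC.f_gt_of_mem_Icc hα, fun lam hlam hρ δ₀ hf α₁ hα => ?_⟩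
  have hδ0 : 0 < δ₀ := by
    by_contra! hc
    -- If `δ₀ ≤ 0`, the interval contains `0`, where `f` vanishes; so the hypothesis on `f` already
    -- forces `δ₀ > 0`.
    have h := hf 0 ⟨hc, by linarith⟩
    simp [TwoBEC.f] at h
    norm_num at h
  have hα0 : 0 < α₁ := hδ0.trans_le hα.1
  have hα1 : α₁ < 1 := by linarith [hα.2]
  have hl4 := TwoBEC.pi_mul_pow_four hlam hρ
  have hs := TwoBEC.sigma_pos
  have hpi := Real.pi_pos
  have hX := TwoBEC.indicator_sector_mem_X hlam hρ hα0 hα1 0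
  have hsector : TwoBEC.IsDiskSector lam
      ((TwoBEC.sector lam 0 (2 * Real.pi * α₁))ᶜ.indicator fun _ => Real.pi) := by
    refine ⟨0, 2 * Real.pi * α₁, by positivity, by nlinarith, Filter.EventuallyEq.of_eq ?_⟩
    refine Set.ext fun x => ?_
    rw [Set.mem_ofPred_eq]
    constructor
    · rintro ⟨-, h⟩
      by_contra hx
      rw [Set.indicator_of_mem hx] at h
      exact hpi.ne' h
    · intro hx
      exact ⟨TwoBEC.sector_subset_disk _ _ _ hx, Set.indicator_of_notMem (Set.notMem_compl_iff.2 hx) _⟩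
  have henergy : ∀ φds ∈ TwoBEC.X lam α₁, TwoBEC.IsDiskSector lam φds →
      TwoBEC.energy lam φds = ENNReal.ofReal (8 * TwoBEC.sigma * (3 / 16)) := by
    rintro φds hφ ⟨θ, β, hβ0, hβ, hae⟩
    exact TwoBEC.energy_sector hlam hl4 hβ0 hβ (TwoBEC.eq_indicator_of_sector hφ.2.1 hae)
  have hrad : ∀ φ ∈ TwoBEC.X lam α₁, TwoBEC.IsRadial lam φ →
      ENNReal.ofReal (8 * TwoBEC.sigma * (3 / 16)) < TwoBEC.energy lam φ :=
    fun φ hφ hr => TwoBEC.lt_energy_of_isRadial hlam hρ hδ0 hf hα hφ hr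
  refine ⟨fun φ hmin hr => ?_, fun φ hφ hr => ?_, ⟨_, hX, hsector⟩, fun φds hφds hds =>
    ⟨?_, fun φ hφ hr => ?_⟩⟩
  · have h := hmin.2 _ hX
    rw [henergy _ hX hsector] at h
    exact (hrad φ hmin.1 hr).not_ge h
  · obtain ⟨⟨hloc, μ, hμ⟩, hv, -⟩ := hφ
    obtain ⟨E, hE⟩ := TwoBEC.exists_isProfile hloc.aestronglyMeasurable hv hr
    exact TwoBEC.isUnionOfAnnuli_of_isProfile hlam hμ hE
  · rw [henergy φds hφds hds, ← ENNReal.ofReal_div_of_pos (by positivity),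
      mul_div_cancel_left₀ _ (by positivity), ENNReal.ofReal_div_of_pos (by norm_num)]
    norm_num
  · rw [henergy φds hφds hds]
    exact hrad φ hφ hr
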